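/- Let $p$ be an odd prime, $m\ge 1$ an integer, $q=p^m$, let $K=GF(q^2)$ be a field of order $q^2$, let $\alpha(x)=x^q$ be its automorphism of order $2$, and let $\zeta$ be a primitive element of $K$ (a generator of $K^\times$). Write $\mathbb P^1(K)=K\cup\{\infty\}$ and extend $\alpha$ to $\mathbb P^1(K)$ by $\alpha(\infty)=\infty$. The Zassenhaus group $\mathrm M(q^2)$ is the group of all permutations of $\mathbb P^1(K)$ of the form $\omega\mapsto\frac{a\beta(\omega)+b}{c\beta(\omega)+d}$ with $a,b,c,d\in K$ and $\Delta=ad-bc\ne0$, where $\beta=\mathrm{id}$ if $\Delta\in(K^\times)^2$ and $\beta=\alpha$ otherwise. For a group $G$ and a homomorphism $\varphi:G\to\mathrm{Aut}(G)$ put $g_1\circ_\varphi g_2=g_1\cdot\varphi(g_1)^{-1}(g_2)$; if this operation is associative, then $G_\varphi=(G,\circ_\varphi)$ is a group, the deformation of $G$ by $\varphi$. Let $\bar\varphi:PGL_2(K)\to\mathrm{Aut}(PGL_2(K))$ send the class of a matrix $A$ to the identity if $\det A\in(K^\times)^2$, and otherwise to the automorphism $\bar\alpha$ induced by $\alpha$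 (applied to the matrix entries); the operation $\circ_{\bar\varphi}$ is associative. Then: 1. $\mathrm M(q^2)$ is sharply $3$-transitive on $\mathbb P^1(K)$. 2. Sending the class of $\begin{pmatrix}a&b\\c&d\end{pmatrix}$ to the transformation $\omega\mapsto\frac{a\beta(\omega)+b}{c\beta(\omega)+d}$ is an isomorphism $(PGL_2(K))_{\bar\varphi}\cong\mathrm M(q^2)$. 3. The group $(PGL_2(K))_{\bar\varphi}\cong\mathrm M(q^2)$ is generated by symbols $a,T,J$, corresponding to the classes of $\begin{pmatrix}\zeta^{-1}&0\\0&1\end{pmatrix}$, $\begin{pmatrix}1&-1\\0&-1\end{pmatrix}$, $\begin{pmatrix}0&-1\\-1&0\end{pmatrix}$ respectively, subject to the defining relations $$[J,a]^{\frac{q^2-1}{2}}=1,\qquad a^2=[J,a]^{-\frac{q+1}{2}},\qquad a^{[J,a]}=[J,a]^{q-1}a,\qquad T^2=1,$$ $$T R(\zeta^j)T=R(\zeta^{k_j})\,T\,R\big(\zeta^{\frac{q^2-1}{2}-k_j+j}\big)\quad(1\le j<q^2-1,\ 2\mid k_j),$$ $$T R(\zeta^j)T=R(\zeta^{k_j})\,T\,R\big(\zeta^{\frac{q^2-1}{2}-qk_j+qj}\big)\quad(1\le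 j<q^2-1,\ 2\nmid k_j),$$ $$J^2=(J[J,a])^2=(JT)^3=1.$$ Here $[x,y]=xyx^{-1}y^{-1}$ and $x^y=y^{-1}xy$; $k_j$ is the integer with $1\le k_j<q^2-1$ and $1-\zeta^j=\zeta^{k_j}$; and $R(\zeta^k)$ stands for the word $[J,a]^{\lceil k/2\rceil}a^{\,k-2\lfloor k/2\rfloor}$ for $1\le k<q^2-1$, exponents of $\zeta$ being first reduced modulo $q^2-1$ to this range. -/

import Mathlib

namespace Zassenhaus

open scoped MatrixGroups

/-! ### Deformations of a group -/

section Deformation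

variable {G : Type*} [Group G]

/-- The operation `g₁ ∘_φ g₂ = g₁ · φ(g₁)⁻¹(g₂)` attached to an action `φ` by automorphisms of the
group `G` on itself. -/
def deformedMul (φ : G →* MulAut G) (g₁ g₂ : G) : G := g₁ * (φ g₁)⁻¹ g₂

/-- An action by automorphisms of `G` on itself is admissible if `∘_φ` is associative. -/
class IsAdmissible (φ : G →* MulAut G) : Prop where
  assoc : ∀ g₁ g₂ g₃ : G,
    deformedMul φ (deformedMul φ g₁ g₂) g₃ = deformedMul φ g₁ (deformedMul φ g₂ g₃)

/-- The deformation `G_φ`: a copy of the set `G`, to be equipped with `∘_φ`. For `g : G`,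
`Deformation.of φ g` is `g` regarded as an element of `G_φ`. -/
@[ext]
structure Deformation (φ : G →* MulAut G) where
  /-- Regard an element of `G` as an element of `G_φ`. -/
  of (φ) ::
  /-- Regard an element of `G_φ` as an element of `G`. -/
  val : G

instance (φ : G →* MulAut G) : Mul (Deformation φ) :=
  ⟨fun x y => Deformation.of φ (deformedMul φ x.val y.val)⟩

instance (φ : G →* MulAut G) : One (Deformation φ) := ⟨Deformation.of φ 1⟩

instance (φ : G →* MulAut G) : Inv (Deformation φ) :=
  ⟨fun x => Deformation.of φ (φ x.val x.val)⁻¹⟩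

/-- For admissible `φ`, `G_φ` is a group: the operation is `∘_φ`, the neutral element is that of
`G`, and the inverse of `g` is `φ(g)(g)⁻¹`. -/
instance (φ : G →* MulAut G) [IsAdmissible φ] : Group (Deformation φ) :=
  Group.ofRightAxioms
    (fun x y z => Deformation.ext (IsAdmissible.assoc x.val y.val z.val))
    (fun x => Deformation.ext (by
      change x.val * (φ x.val)⁻¹ 1 = x.val
      rw [map_one, mul_one]))
    (fun x => Deformation.ext (by
      change x.val * (φ x.val)⁻¹ (φ x.val x.val)⁻¹ = 1
      rw [map_inv, MulAut.inv_apply_self, mul_inv_cancel]))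

theorem Deformation.of_mul_of (φ : G →* MulAut G) [IsAdmissible φ] (g₁ g₂ : G) :
    of φ g₁ * of φ g₂ = of φ (g₁ * (φ g₁)⁻¹ g₂) := rfl

end Deformation

/-! ### Squares in a finite field -/

section Squares

variable {K : Type*} [Field K]

theorem isSquare_mul_of_not [Finite K] {u v : Kˣ} (hu : ¬ IsSquare u) (hv : ¬ IsSquare v) :
    IsSquare (u * v) := by
  obtain ⟨g, hg⟩ := IsCyclic.exists_generator (α := Kˣ)
  obtain ⟨i, rfl⟩ := Subgroup.mem_zpowers_iff.1 (hg u)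
  obtain ⟨j, rfl⟩ := Subgroup.mem_zpowers_iff.1 (hg v)
  rw [← zpow_add]
  refine Even.isSquare_zpow ?_ g
  have hi : ¬ Even i := fun h => hu (h.isSquare_zpow g)
  have hj : ¬ Even j := fun h => hv (h.isSquare_zpow g)
  rw [Int.not_even_iff_odd] at hi hj
  exact hi.add_odd hj

open scoped Classical in
/-- The homomorphism `Kˣ → Kˣ/(Kˣ)² → M` (`K` a finite field) sending squares to `1` and
non-squares to the given element `τ` with `τ² = 1`. -/
noncomputable def nonsquareHom [Finite K] {M : Type*} [Monoid M] (τ : M) (hτ : τ * τ = 1) :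
    Kˣ →* M where
  toFun u := if IsSquare u then 1 else τ
  map_one' := if_pos IsSquare.one
  map_mul' u v := by
    by_cases hu : IsSquare u <;> by_cases hv : IsSquare v
    · simp [hu, hv, hu.mul hv]
    · have : ¬ IsSquare (u * v) := fun h => hv (by simpa using hu.inv.mul h)
      simp [hu, hv, this]
    · have : ¬ IsSquare (u * v) := fun h => hu (by simpa using h.mul hv.inv)
      simp [hu, hv, this]
    · simp [hu, hv, isSquare_mul_of_not hu hv, hτ]

end Squares

/-! ### The field of order `q²`, the involution `x ↦ x ^ q`, and the action `φ̄` -/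

section Field

variable {p m : ℕ} [hp : Fact p.Prime] {K : Type*} [Field K]

theorem finite_of_card (hK : Nat.card K = (p ^ m) ^ 2) : Finite K :=
  Nat.finite_of_card_ne_zero (by rw [hK]; exact pow_ne_zero _ (pow_ne_zero _ hp.out.ne_zero))

theorem charP_of_card (hK : Nat.card K = (p ^ m) ^ 2) : CharP K p := by
  have := finite_of_card hK
  let _ := Fintype.ofFinite K
  refine charP_of_card_eq_prime_pow (f := m * 2) ?_
  rw [← Nat.card_eq_fintype_card, hK, pow_mul]

/-- The automorphism `α : x ↦ x ^ q` of a field `K` of order `q²`, where `q = p ^ m`: the `m`-th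
power of the Frobenius automorphism. -/
noncomputable def conj (hK : Nat.card K = (p ^ m) ^ 2) : K ≃+* K :=
  haveI := finite_of_card hK
  haveI := charP_of_card hK
  iterateFrobeniusEquiv K p m

theorem conj_apply (hK : Nat.card K = (p ^ m) ^ 2) (x : K) : conj hK x = x ^ p ^ m := by
  have := finite_of_card hK
  have := charP_of_card hK
  exact iterateFrobenius_def p m x

theorem conj_conj (hK : Nat.card K = (p ^ m) ^ 2) (x : K) : conj hK (conj hK x) = x := by
  have := finite_of_card hK
  let _ := Fintype.ofFinite K
  rw [conj_apply, conj_apply, ← pow_mul, ← sq, ← hK, Nat.card_eq_fintype_card,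
    FiniteField.pow_card]

/-- The automorphism of `GL₂(K)` induced by `α` (entrywise). -/
noncomputable def conjGL (hK : Nat.card K = (p ^ m) ^ 2) : MulAut (GL (Fin 2) K) where
  toFun := Matrix.GeneralLinearGroup.map (conj hK : K →+* K)
  invFun := Matrix.GeneralLinearGroup.map (conj hK : K →+* K)
  left_inv A := by ext i j; simp [conj_conj]
  right_inv A := by ext i j; simp [conj_conj]
  map_mul' := map_mul _

theorem conjGL_apply (hK : Nat.card K = (p ^ m) ^ 2) (A : GL (Fin 2) K) :
    conjGL hK A = Matrix.GeneralLinearGroup.map (conj hK : K →+* K) A := rfl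

theorem conjGL_conjGL (hK : Nat.card K = (p ^ m) ^ 2) (A : GL (Fin 2) K) :
    conjGL hK (conjGL hK A) = A := (conjGL hK).left_inv A

/-- The automorphism `ᾱ` of `PGL₂(K)` induced by `α`. -/
noncomputable def conjPGL (hK : Nat.card K = (p ^ m) ^ 2) : MulAut PGL(2, K) :=
  QuotientGroup.congr (Subgroup.center (GL (Fin 2) K)) (Subgroup.center (GL (Fin 2) K))
    (conjGL hK) (Subgroup.characteristic_iff_map_eq.1 inferInstance (conjGL hK))

theorem conjPGL_mk (hK : Nat.card K = (p ^ m) ^ 2) (A : GL (Fin 2) K) :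
    conjPGL hK (Matrix.ProjGenLinGroup.mk A) = Matrix.ProjGenLinGroup.mk (conjGL hK A) := rfl

theorem conjPGL_mul_self (hK : Nat.card K = (p ^ m) ^ 2) : conjPGL hK * conjPGL hK = 1 := by
  ext x
  induction x using Matrix.ProjGenLinGroup.induction_on with
  | mk A => rw [MulAut.mul_apply, conjPGL_mk, conjPGL_mk, conjGL_conjGL, MulAut.one_apply]

/-- The action `φ̄ : PGL₂(K) → Aut(PGL₂(K))`: the class of a matrix acts trivially if the
determinant is a square in `Kˣ`, and as `ᾱ` otherwise (see `phiBar_mk`). -/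
noncomputable def phiBar (hK : Nat.card K = (p ^ m) ^ 2) : PGL(2, K) →* MulAut PGL(2, K) :=
  haveI := finite_of_card hK
  QuotientGroup.lift (Subgroup.center (GL (Fin 2) K))
    ((nonsquareHom (conjPGL hK) (conjPGL_mul_self hK)).comp Matrix.GeneralLinearGroup.det)
    (by
      intro A hA
      rw [Matrix.GeneralLinearGroup.center_eq_range_scalar] at hA
      obtain ⟨u, rfl⟩ := hA
      refine if_pos ⟨u, ?_⟩
      ext
      simp [sq])

open scoped Classical in
theorem phiBar_mk (hK : Nat.card K = (p ^ m) ^ 2) (A : GL (Fin 2) K) :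
    phiBar hK (Matrix.ProjGenLinGroup.mk A) =
      if IsSquare (Matrix.GeneralLinearGroup.det A) then 1 else conjPGL hK := rfl

theorem isSquare_map_conj (hK : Nat.card K = (p ^ m) ^ 2) (A : GL (Fin 2) K) :
    IsSquare (Matrix.GeneralLinearGroup.det (conjGL hK A)) ↔
      IsSquare (Matrix.GeneralLinearGroup.det A) := by
  have key : ∀ B : GL (Fin 2) K, IsSquare (Matrix.GeneralLinearGroup.det B) →
      IsSquare (Matrix.GeneralLinearGroup.det (conjGL hK B)) := by
    intro B hB
    have : Matrix.GeneralLinearGroup.det (conjGL hK B)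
        = Units.map (conj hK : K →* K) (Matrix.GeneralLinearGroup.det B) := by
      ext
      simp [conjGL_apply, Matrix.det_fin_two]
    rw [this]
    exact hB.map _
  exact ⟨fun h => by simpa only [conjGL_conjGL] using key _ h, key A⟩

/-- `φ̄` is admissible. -/
instance (hK : Nat.card K = (p ^ m) ^ 2) : IsAdmissible (phiBar hK) where
  assoc x y z := by
    have h1 : ∀ w : PGL(2, K), phiBar hK w = 1 ∨ phiBar hK w = conjPGL hK := by
      intro w
      induction w using Matrix.ProjGenLinGroup.induction_on with
      | mk A => rw [phiBar_mk]; split_ifs <;> simp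
    have h2 : ∀ w : PGL(2, K), phiBar hK (conjPGL hK w) = phiBar hK w := by
      intro w
      induction w using Matrix.ProjGenLinGroup.induction_on with
      | mk A =>
        rw [conjPGL_mk, phiBar_mk, phiBar_mk]
        by_cases h : IsSquare (Matrix.GeneralLinearGroup.det A)
        · rw [if_pos h, if_pos ((isSquare_map_conj hK A).2 h)]
        · rw [if_neg h, if_neg (fun h' => h ((isSquare_map_conj hK A).1 h'))]
    have h3 : (conjPGL hK)⁻¹ = conjPGL hK := inv_eq_of_mul_eq_one_left (conjPGL_mul_self hK)
    have h4 : phiBar hK ((phiBar hK x)⁻¹ y) = phiBar hK y := by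
      rcases h1 x with h | h <;> rw [h]
      · simp
      · rw [h3, h2]
    have h5 : phiBar hK x * phiBar hK y = phiBar hK y * phiBar hK x := by
      rcases h1 x with h | h <;> rcases h1 y with h' | h' <;> rw [h, h'] <;> simp
    simp only [deformedMul, map_mul, h4, h5, mul_inv_rev, MulAut.mul_apply, mul_assoc]

/-! ### The Zassenhaus group `M(q²)` as a permutation group of the projective line -/

open scoped Classical in
/-- The extension to `ℙ¹(K) = K ∪ {∞}` of the field automorphism `β` attached to `A`: it is the
identity if `det A` is a square in `Kˣ`, and otherwise it is `α`, extended by `α(∞) = ∞`. -/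
noncomputable def beta (hK : Nat.card K = (p ^ m) ^ 2) (A : GL (Fin 2) K) (ω : OnePoint K) :
    OnePoint K :=
  if IsSquare (Matrix.GeneralLinearGroup.det A) then ω else OnePoint.map (conj hK) ω

open scoped Classical in
/-- The transformation `ω ↦ (a β(ω) + b) / (c β(ω) + d)` of `ℙ¹(K)` attached to an invertible
matrix `A = !![a, b; c, d]`; here `•` is the usual action by Möbius transformations. -/
noncomputable def semiMoebius (hK : Nat.card K = (p ^ m) ^ 2) (A : GL (Fin 2) K)
    (ω : OnePoint K) : OnePoint K :=
  A • beta hK A ω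

theorem semiMoebius_one (hK : Nat.card K = (p ^ m) ^ 2) (ω : OnePoint K) :
    semiMoebius hK 1 ω = ω := by
  simp [semiMoebius, beta]

open scoped Classical in
theorem exists_semiMoebius_comp (hK : Nat.card K = (p ^ m) ^ 2) (A B : GL (Fin 2) K) :
    ∃ C : GL (Fin 2) K, ∀ ω, semiMoebius hK A (semiMoebius hK B ω) = semiMoebius hK C ω := by
  have := finite_of_card hK
  have hmap : ∀ (D : GL (Fin 2) K) (ω : OnePoint K),
      OnePoint.map (conj hK) (D • ω) = conjGL hK D • OnePoint.map (conj hK) ω :=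
    fun D ω => OnePoint.map_smul (conj hK : K →+* K) D ω
  have hinv : ∀ ω : OnePoint K, OnePoint.map (conj hK) (OnePoint.map (conj hK) ω) = ω := by
    intro ω
    cases ω <;> simp [conj_conj]
  have hdet := isSquare_map_conj hK B
  by_cases hA : IsSquare (Matrix.GeneralLinearGroup.det A) <;>
    by_cases hB : IsSquare (Matrix.GeneralLinearGroup.det B)
  · refine ⟨A * B, fun ω => ?_⟩
    have : IsSquare (Matrix.GeneralLinearGroup.det (A * B)) := by
      rw [map_mul]; exact hA.mul hB
    simp only [semiMoebius, beta, if_pos hA, if_pos hB, if_pos this, mul_smul]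
  · refine ⟨A * B, fun ω => ?_⟩
    have : ¬ IsSquare (Matrix.GeneralLinearGroup.det (A * B)) := by
      rw [map_mul]
      exact fun h => hB (by simpa using hA.inv.mul h)
    simp only [semiMoebius, beta, if_pos hA, if_neg hB, if_neg this, mul_smul]
  · refine ⟨A * conjGL hK B, fun ω => ?_⟩
    have : ¬ IsSquare (Matrix.GeneralLinearGroup.det (A * conjGL hK B)) := by
      rw [map_mul]
      exact fun h => hA (by simpa using h.mul (hdet.2 hB).inv)
    simp only [semiMoebius, beta, if_neg hA, if_pos hB, if_neg this, mul_smul, hmap]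
  · refine ⟨A * conjGL hK B, fun ω => ?_⟩
    have : IsSquare (Matrix.GeneralLinearGroup.det (A * conjGL hK B)) := by
      rw [map_mul]
      exact isSquare_mul_of_not hA (fun h => hB (hdet.1 h))
    simp only [semiMoebius, beta, if_neg hA, if_neg hB, if_pos this, mul_smul, hmap, hinv]

open scoped Classical in
theorem exists_semiMoebius_leftInv (hK : Nat.card K = (p ^ m) ^ 2) (A : GL (Fin 2) K) :
    ∃ C : GL (Fin 2) K, ∀ ω, semiMoebius hK C (semiMoebius hK A ω) = ω := by
  have hmap : ∀ (D : GL (Fin 2) K) (ω : OnePoint K),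
      OnePoint.map (conj hK) (D • ω) = conjGL hK D • OnePoint.map (conj hK) ω :=
    fun D ω => OnePoint.map_smul (conj hK : K →+* K) D ω
  have hinv : ∀ ω : OnePoint K, OnePoint.map (conj hK) (OnePoint.map (conj hK) ω) = ω := by
    intro ω
    cases ω <;> simp [conj_conj]
  by_cases hA : IsSquare (Matrix.GeneralLinearGroup.det A)
  · refine ⟨A⁻¹, fun ω => ?_⟩
    have : IsSquare (Matrix.GeneralLinearGroup.det A⁻¹) := by rw [map_inv]; exact hA.inv
    simp only [semiMoebius, beta, if_pos hA, if_pos this, inv_smul_smul]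
  · refine ⟨conjGL hK A⁻¹, fun ω => ?_⟩
    have : ¬ IsSquare (Matrix.GeneralLinearGroup.det (conjGL hK A⁻¹)) := by
      rw [isSquare_map_conj, map_inv]
      exact fun h => hA (by simpa using h.inv)
    simp only [semiMoebius, beta, if_neg hA, if_neg this, hmap, hinv]
    rw [← mul_smul, ← map_mul, inv_mul_cancel, map_one, one_smul]

/-- The Zassenhaus group `M(q²)`: the group of all permutations of `ℙ¹(K)` of the form
`ω ↦ (a β(ω) + b) / (c β(ω) + d)` with `ad - bc ≠ 0`. -/
def M (hK : Nat.card K = (p ^ m) ^ 2) : Subgroup (Equiv.Perm (OnePoint K)) where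
  carrier := {h | ∃ A : GL (Fin 2) K, ∀ ω, h ω = semiMoebius hK A ω}
  one_mem' := ⟨1, fun ω => (semiMoebius_one hK ω).symm⟩
  mul_mem' := by
    rintro g h ⟨A, hA⟩ ⟨B, hB⟩
    obtain ⟨C, hC⟩ := exists_semiMoebius_comp hK A B
    exact ⟨C, fun ω => by rw [Equiv.Perm.mul_apply, hA, hB, hC]⟩
  inv_mem' := by
    rintro g ⟨A, hA⟩
    obtain ⟨C, hC⟩ := exists_semiMoebius_leftInv hK A
    refine ⟨C, fun ω => ?_⟩
    have := hC (g⁻¹ ω)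
    rw [← hA, ← Equiv.Perm.mul_apply, mul_inv_cancel, Equiv.Perm.one_apply] at this
    exact this.symm

end Field

/-- A permutation group on `Ω` is sharply `3`-transitive if any triple of distinct points is
carried to any other such triple by exactly one element of the group. -/
def IsSharplyThreeTransitive {Ω : Type*} (G : Subgroup (Equiv.Perm Ω)) : Prop :=
  ∀ x y : Fin 3 → Ω, Function.Injective x → Function.Injective y →
    ∃! g : Equiv.Perm Ω, g ∈ G ∧ ∀ i, g (x i) = y i

/-! ### The presentation -/

/-- The three generating symbols. -/
inductive Gen
  | a
  | T
  | J

namespace Gen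

/-- The free generator `a`. -/
def wa : FreeGroup Gen := FreeGroup.of Gen.a

/-- The free generator `T`. -/
def wT : FreeGroup Gen := FreeGroup.of Gen.T

/-- The free generator `J`. -/
def wJ : FreeGroup Gen := FreeGroup.of Gen.J

/-- The commutator `[J, a] = J a J⁻¹ a⁻¹`. -/
def wb : FreeGroup Gen := wJ * wa * wJ⁻¹ * wa⁻¹

/-- The word `[J, a] ^ ⌈k / 2⌉ * a ^ (k - 2 ⌊k / 2⌋)`. -/
def wR (k : ℕ) : FreeGroup Gen := wb ^ ((k + 1) / 2) * wa ^ (k - 2 * (k / 2))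

/-- The word that `R(ζ ^ e)` stands for, where `ζ` has order `q² - 1` and `e` is any integer: the
exponent is first reduced modulo `q² - 1`. -/
def wRζ (q : ℕ) (e : ℤ) : FreeGroup Gen := wR (e % ((q : ℤ) ^ 2 - 1)).toNat

end Gen

open Gen

/-- The relators `l * r⁻¹` of the relations `l = r` of the presentation; `k` is the index
`k_j` determined by `j` through `1 - ζ ^ j = ζ ^ k` and `1 ≤ k < q² - 1`, and `x ^ y = y⁻¹ x y`. -/
def relators {K : Type*} [Field K] (q : ℕ) (ζ : Kˣ) : Set (FreeGroup Gen) :=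
  { wb ^ ((q ^ 2 - 1) / 2),
    wa ^ 2 * (wb⁻¹ ^ ((q + 1) / 2))⁻¹,
    (wb⁻¹ * wa * wb) * (wb ^ (q - 1) * wa)⁻¹,
    wT ^ 2,
    wJ ^ 2,
    (wJ * wb) ^ 2,
    (wJ * wT) ^ 3 } ∪
  { w | ∃ j k : ℕ, 1 ≤ j ∧ j < q ^ 2 - 1 ∧ 1 ≤ k ∧ k < q ^ 2 - 1 ∧
      1 - (ζ : K) ^ j = (ζ : K) ^ k ∧ Even k ∧
      w = (wT * wRζ q j * wT) *
        (wRζ q k * wT * wRζ q (((q : ℤ) ^ 2 - 1) / 2 - k + j))⁻¹ } ∪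
  { w | ∃ j k : ℕ, 1 ≤ j ∧ j < q ^ 2 - 1 ∧ 1 ≤ k ∧ k < q ^ 2 - 1 ∧
      1 - (ζ : K) ^ j = (ζ : K) ^ k ∧ ¬ Even k ∧
      w = (wT * wRζ q j * wT) *
        (wRζ q k * wT * wRζ q (((q : ℤ) ^ 2 - 1) / 2 - q * k + q * j))⁻¹ }

/-- The matrix `R(u) = !![u, 0; 0, 1]`. -/
def matR {K : Type*} [Field K] (u : Kˣ) : GL (Fin 2) K :=
  Matrix.GeneralLinearGroup.mkOfDetNeZero !![(u : K), 0; 0, 1] (by simp [Matrix.det_fin_two])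

/-- The matrix `!![1, -1; 0, -1]`. -/
def matT (K : Type*) [Field K] : GL (Fin 2) K :=
  Matrix.GeneralLinearGroup.mkOfDetNeZero !![(1 : K), -1; 0, -1] (by simp [Matrix.det_fin_two])

/-- The matrix `!![0, -1; -1, 0]`. -/
def matJ (K : Type*) [Field K] : GL (Fin 2) K :=
  Matrix.GeneralLinearGroup.mkOfDetNeZero !![(0 : K), -1; -1, 0] (by simp [Matrix.det_fin_two])

end Zassenhaus

/-!
Field automorphisms fix `∞, 0, 1`, so an element of `M(q²)` fixing these three points has a Möbius
factor fixing them, which is trivial: elements of `M(q²)` are determined by the images of `∞, 0, 1`.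
So `M(q²)` is sharply `3`-transitive once each triple can be moved to `(∞, 0, 1)`, and the defining
relations hold in `M(q²)` as soon as their two sides agree at these points.

Conversely, in the presented group the first three relations make `R(ζ ^ e)` run over a subgroup `H`
with the multiplication of the stabilizer of `0` and `∞`. The relations for `T R(ζ ^ j) T` then give
that `B = H ∪ H T H` is a subgroup, and `J T J = T J T` that the whole group is `B ∪ B J B`. Hence
the action on the projective line is faithful: elements of `B J B` move `∞`, those of `H T H` fix
`∞` but move `0`, and an element of `H` is recovered from the image of `1`.
-/

namespace Zassenhaus

open scoped MatrixGroups OnePoint commutatorElement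
open Gen

/-! ### Rank-two Bruhat decomposition -/

section Bruhat

variable {G : Type*} [Group G] {H : Subgroup G} {T J : G}

/-- Rank-two Bruhat relations: two involutions `T`, `J` and a "torus" `H` multiplying in the way
that `ω ↦ 1 - ω`, `ω ↦ ω⁻¹` and the stabilizer of `0` and `∞` do in a sharply `3`-transitive group
of permutations of a projective line. -/
structure IsBruhatTriple (H : Subgroup G) (T J : G) : Prop where
  T_sq : T * T = 1
  J_sq : J * J = 1
  J_conj_mem : ∀ x ∈ H, J * x * J ∈ H
  T_conj_mem : ∀ x ∈ H, x ≠ 1 → T * x * T ∈ DoubleCoset.doubleCoset T H H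
  braid : J * T * J = T * J * T

/-- The union `H ∪ H T H`, in a Bruhat triple the subgroup generated by `H` and `T`. -/
def borel (H : Subgroup G) (T : G) : Set G := H ∪ DoubleCoset.doubleCoset T H H

/-- The union `B ∪ B J B` for `B = H ∪ H T H`, the two cells of the Bruhat decomposition. -/
def bruhatCells (H : Subgroup G) (T J : G) : Set G :=
  borel H T ∪ DoubleCoset.doubleCoset J (borel H T) (borel H T)

theorem mul_mem_borel {x g : G} (hx : x ∈ H) (hg : g ∈ borel H T) : x * g ∈ borel H T := by
  obtain hg | hg := hg
  · exact Or.inl (H.mul_mem hx hg)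
  · obtain ⟨y, hy, z, hz, rfl⟩ := DoubleCoset.mem_doubleCoset.1 hg
    exact Or.inr (DoubleCoset.mem_doubleCoset.2
      ⟨x * y, H.mul_mem hx hy, z, hz, by simp only [mul_assoc]⟩)

theorem mul_mem_bruhatCells {x g : G} (hx : ∀ y ∈ borel H T, x * y ∈ borel H T)
    (hg : g ∈ bruhatCells H T J) : x * g ∈ bruhatCells H T J := by
  obtain hg | hg := hg
  · exact Or.inl (hx g hg)
  · obtain ⟨y, hy, z, hz, rfl⟩ := DoubleCoset.mem_doubleCoset.1 hg
    exact Or.inr (DoubleCoset.mem_doubleCoset.2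
      ⟨x * y, hx y hy, z, hz, by simp only [mul_assoc]⟩)

namespace IsBruhatTriple

theorem T_mul_mem_borel (hB : IsBruhatTriple H T J) {g : G} (hg : g ∈ borel H T) :
    T * g ∈ borel H T := by
  obtain hg | hg := hg
  · exact Or.inr (DoubleCoset.mem_doubleCoset.2 ⟨1, H.one_mem, g, hg, by rw [one_mul]⟩)
  obtain ⟨x, hx, y, hy, rfl⟩ := DoubleCoset.mem_doubleCoset.1 hg
  obtain rfl | hx1 := eq_or_ne x 1
  · exact Or.inl (by simpa only [one_mul, ← mul_assoc, hB.T_sq] using hy)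
  · obtain ⟨z, hz, w, hw, hTxT⟩ := DoubleCoset.mem_doubleCoset.1 (hB.T_conj_mem x hx hx1)
    refine Or.inr (DoubleCoset.mem_doubleCoset.2 ⟨z, hz, w * y, H.mul_mem hw hy, ?_⟩)
    simp only [← mul_assoc, hTxT]

theorem J_mul_mem_bruhatCells (hB : IsBruhatTriple H T J) {g : G}
    (hg : g ∈ bruhatCells H T J) : J * g ∈ bruhatCells H T J := by
  obtain hg | hg := hg
  · exact Or.inr (DoubleCoset.mem_doubleCoset.2 ⟨1, Or.inl H.one_mem, g, hg, by rw [one_mul]⟩)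
  obtain ⟨x, hx | hx, y, hy, rfl⟩ := DoubleCoset.mem_doubleCoset.1 hg
  · refine Or.inl ?_
    simpa only [mul_assoc] using mul_mem_borel (hB.J_conj_mem x hx) hy
  · obtain ⟨z, hz, w, hw, rfl⟩ := DoubleCoset.mem_doubleCoset.1 hx
    have hcell : J * (z * T * w * J * y) = J * z * J * T * J * (T * (J * w * J * y)) :=
      calc J * (z * T * w * J * y)
          = J * z * (J * J) * T * (J * J) * w * J * y := by
            simp only [hB.J_sq, mul_one, mul_assoc]
        _ = J * z * J * (J * T * J) * (J * w * J * y) := by simp only [mul_assoc]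
        _ = J * z * J * T * J * (T * (J * w * J * y)) := by
          rw [hB.braid]; simp only [mul_assoc]
    refine Or.inr (DoubleCoset.mem_doubleCoset.2 ⟨J * z * J * T, Or.inr ?_, _,
      hB.T_mul_mem_borel (mul_mem_borel (hB.J_conj_mem w hw) hy), hcell⟩)
    exact DoubleCoset.mem_doubleCoset.2
      ⟨_, hB.J_conj_mem z hz, 1, H.one_mem, (mul_one _).symm⟩

theorem mem_bruhatCells (hB : IsBruhatTriple H T J)
    (hgen : Subgroup.closure (insert T (insert J (H : Set G))) = ⊤) (g : G) :
    g ∈ bruhatCells H T J := by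
  have hg : g ∈ Subgroup.closure (insert T (insert J (H : Set G))) := hgen ▸ Subgroup.mem_top g
  have hTinv : T⁻¹ = T := inv_eq_of_mul_eq_one_left hB.T_sq
  have hJinv : J⁻¹ = J := inv_eq_of_mul_eq_one_left hB.J_sq
  have hmul : ∀ x ∈ insert T (insert J (H : Set G)), ∀ y ∈ bruhatCells H T J,
      x * y ∈ bruhatCells H T J := by
    rintro x (rfl | rfl | hx) y hy
    · exact mul_mem_bruhatCells (fun z => hB.T_mul_mem_borel) hy
    · exact hB.J_mul_mem_bruhatCells hy
    · exact mul_mem_bruhatCells (fun z => mul_mem_borel hx) hy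
  induction hg using Subgroup.closure_induction_left with
  | one => exact Or.inl (Or.inl H.one_mem)
  | mul_left x hx y _ ih => exact hmul x hx y ih
  | inv_mul_cancel x hx y _ ih =>
    refine hmul x⁻¹ ?_ y ih
    obtain rfl | rfl | hx := hx
    · exact Or.inl hTinv
    · exact Or.inr (Or.inl hJinv)
    · exact Or.inr (Or.inr (H.inv_mem hx))

variable {G' Ω : Type*} [Group G'] [MulAction G' Ω] {f : G →* G'} {o z : Ω}

theorem map_injective (hB : IsBruhatTriple H T J)
    (hgen : Subgroup.closure (insert T (insert J (H : Set G))) = ⊤)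
    (hHo : ∀ x ∈ H, f x • o = o) (hHz : ∀ x ∈ H, f x • z = z)
    (hTo : f T • o = o) (hTz : f T • z ≠ z) (hJo : f J • o ≠ o)
    (hker : ∀ x ∈ H, f x = 1 → x = 1) : Function.Injective f := by
  rw [injective_iff_map_eq_one]
  intro g hg
  have hborel : ∀ x ∈ borel H T, f x • o = o := by
    rintro x (hx | hx)
    · exact hHo x hx
    · obtain ⟨y, hy, w, hw, rfl⟩ := DoubleCoset.mem_doubleCoset.1 hx
      rw [map_mul, map_mul, mul_smul, mul_smul, hHo w hw, hTo, hHo y hy]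
  obtain (hx | hx) | hx := hB.mem_bruhatCells hgen g
  · exact hker g hx hg
  · obtain ⟨y, hy, w, hw, rfl⟩ := DoubleCoset.mem_doubleCoset.1 hx
    refine absurd (smul_left_cancel (f y) ?_) hTz
    calc f y • f T • z = f (y * T * w) • z := by
          rw [map_mul, map_mul, mul_smul, mul_smul, hHz w hw]
      _ = f y • z := by rw [hg, one_smul, hHz y hy]
  · obtain ⟨y, hy, w, hw, rfl⟩ := DoubleCoset.mem_doubleCoset.1 hx
    refine absurd (smul_left_cancel (f y) ?_) hJo
    calc f y • f J • o = f (y * J * w) • o := by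
          rw [map_mul, map_mul, mul_smul, mul_smul, hborel w hw]
      _ = f y • o := by rw [hg, one_smul, hborel y hy]

end IsBruhatTriple

end Bruhat

/-! ### Sharply `3`-transitive permutation groups -/

section SharplyTransitive

variable {Ω : Type*} {ω : Fin 3 → Ω} {N G : Subgroup (Equiv.Perm Ω)}

theorem isSharplyThreeTransitive_of_base
    (hbase : ∀ x : Fin 3 → Ω, Function.Injective x → ∃ g ∈ N, ∀ i, g (x i) = ω i)
    (hstab : ∀ g ∈ N, (∀ i, g (ω i) = ω i) → g = 1) : IsSharplyThreeTransitive N := by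
  intro x y hx hy
  obtain ⟨g, hg, hgx⟩ := hbase x hx
  obtain ⟨k, hk, hky⟩ := hbase y hy
  refine ⟨k⁻¹ * g, ⟨N.mul_mem (N.inv_mem hk) hg, fun i => ?_⟩, fun l hl => ?_⟩
  · rw [Equiv.Perm.mul_apply, hgx, ← hky, Equiv.Perm.inv_eq_iff_eq.2 rfl]
  · have hkl : k * l * g⁻¹ = 1 := by
      refine hstab _ (N.mul_mem (N.mul_mem hk hl.1) (N.inv_mem hg)) fun i => ?_
      rw [Equiv.Perm.mul_apply, Equiv.Perm.mul_apply, Equiv.Perm.inv_eq_iff_eq.2 (hgx i).symm,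
        hl.2, hky]
    rw [eq_inv_mul_iff_mul_eq, ← mul_inv_eq_one, hkl]

theorem eq_of_le_of_base (hω : Function.Injective ω) (hle : N ≤ G)
    (hbase : ∀ x : Fin 3 → Ω, Function.Injective x → ∃ g ∈ N, ∀ i, g (x i) = ω i)
    (hstab : ∀ g ∈ G, (∀ i, g (ω i) = ω i) → g = 1) : N = G := by
  refine le_antisymm hle fun g hg => ?_
  obtain ⟨k, hk, hkg⟩ := hbase (g ∘ ω) (g.injective.comp hω)
  have hkg1 : k * g = 1 := hstab _ (G.mul_mem (hle hk) hg) hkg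
  exact eq_inv_of_mul_eq_one_right hkg1 ▸ N.inv_mem hk

theorem exists_mem_map_base {o z e : Ω} {T J : Equiv.Perm Ω} (hT : T ∈ N) (hJ : J ∈ N)
    (hTo : T o = o) (hTe : T e = z) (hJz : J z = o)
    (htorus : ∀ y, y ≠ o → y ≠ z → ∃ g ∈ N, g o = o ∧ g z = z ∧ g y = e)
    {x : Fin 3 → Ω} (hx : Function.Injective x) :
    ∃ g ∈ N, ∀ i, g (x i) = ![o, z, e] i := by
  have hto_z : ∀ y, y ≠ o → ∃ g ∈ N, g o = o ∧ g y = z := by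
    intro y hyo
    obtain rfl | hyz := eq_or_ne y z
    · exact ⟨1, N.one_mem, rfl, rfl⟩
    · obtain ⟨g, hg, hgo, -, hgy⟩ := htorus y hyo hyz
      exact ⟨T * g, N.mul_mem hT hg, by simp [hgo, hTo], by simp [hgy, hTe]⟩
  obtain ⟨g₀, hg₀, hg₀x⟩ : ∃ g ∈ N, g (x 0) = o := by
    obtain hxo | hxo := eq_or_ne (x 0) o
    · exact ⟨1, N.one_mem, hxo⟩
    · obtain ⟨g, hg, -, hgx⟩ := hto_z _ hxo
      exact ⟨J * g, N.mul_mem hJ hg, by simp [hgx, hJz]⟩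
  obtain ⟨g₁, hg₁, hg₁o, hg₁x⟩ := hto_z (g₀ (x 1)) fun h =>
    absurd (hx (g₀.injective (h.trans hg₀x.symm))) (by decide)
  obtain ⟨g₂, hg₂, hg₂o, hg₂z, hg₂x⟩ := htorus (g₁ (g₀ (x 2)))
    (fun h => absurd (hx (g₀.injective (g₁.injective
      (h.trans (by rw [hg₀x, hg₁o] : g₁ (g₀ (x 0)) = o).symm)))) (by decide))
    (fun h => absurd (hx (g₀.injective (g₁.injective (h.trans hg₁x.symm)))) (by decide))
  refine ⟨g₂ * g₁ * g₀, N.mul_mem (N.mul_mem hg₂ hg₁) hg₀, fun i => ?_⟩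
  fin_cases i <;> simp [hg₀x, hg₁o, hg₂o, hg₁x, hg₂z, hg₂x]

end SharplyTransitive

section Deformation

variable {G P : Type*} [Group G] [Group P] {φ : G →* MulAut G} [IsAdmissible φ]

/-- The homomorphism `G_φ → P`, `g ↦ ρ(g) σ(g)`, attached to a homomorphism `ρ` of `G` and to a
homomorphism `σ` of `G` through which `φ` is implemented by conjugation in `P`. -/
def Deformation.lift (ρ σ : G →* P) (hρ : ∀ g y, σ g * ρ y = ρ ((φ g)⁻¹ y) * σ g)
    (hσ : ∀ g y, σ ((φ g)⁻¹ y) = σ y) : Deformation φ →* P :=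
  MonoidHom.mk' (fun g => ρ g.val * σ g.val) fun x y => by
    change ρ (x.val * (φ x.val)⁻¹ y.val) * σ (x.val * (φ x.val)⁻¹ y.val) = _
    rw [map_mul, map_mul, hσ, mul_assoc, mul_assoc, ← mul_assoc (σ x.val), hρ]
    simp only [mul_assoc]

end Deformation

/-! ### The action of the deformation on the projective line -/

section Projective

variable {K : Type*} [Field K]

variable (K) in
/-- The action of field automorphisms on the projective line, fixing `∞`. -/
def autPerm : RingAut K →* Equiv.Perm (OnePoint K) :=
  MonoidHom.toHomPerm
    { toFun σ := OnePoint.map σ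
      map_one' := OnePoint.map_id
      map_mul' σ τ := OnePoint.map_comp σ τ }

variable (K) in
/-- The base points `∞, 0, 1` of the projective line. -/
def basePoint : Fin 3 → OnePoint K := ![∞, (0 : K), (1 : K)]

theorem basePoint_injective : Function.Injective (basePoint K) := by
  intro i j h
  fin_cases i <;> fin_cases j <;> simp_all [basePoint]

variable [DecidableEq K]

theorem scalar_smul (u : Kˣ) (ω : OnePoint K) :
    Matrix.GeneralLinearGroup.scalar (Fin 2) u • ω = ω := by
  cases ω with
  | infty => rw [OnePoint.smul_infty_eq_self_iff]; simp
  | coe x => rw [OnePoint.smul_some_eq_ite]; simp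

variable (K) in
/-- The action of `PGL₂(K)` on the projective line. -/
def moebiusPerm : PGL(2, K) →* Equiv.Perm (OnePoint K) :=
  QuotientGroup.lift (Subgroup.center (GL (Fin 2) K))
    (MulAction.toPermHom (GL (Fin 2) K) (OnePoint K)) (by
      rw [Matrix.GeneralLinearGroup.center_eq_range_scalar]
      rintro _ ⟨u, rfl⟩
      exact Equiv.ext (scalar_smul u))

theorem autPerm_mul_moebiusPerm (σ : RingAut K) (A : GL (Fin 2) K) :
    autPerm K σ * moebiusPerm K (Matrix.ProjGenLinGroup.mk A) =
      moebiusPerm K (Matrix.ProjGenLinGroup.mk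
        (Matrix.GeneralLinearGroup.map (σ : K →+* K) A)) * autPerm K σ :=
  Equiv.ext fun ω => OnePoint.map_smul (σ : K →+* K) A ω

theorem mk_eq_one_of_smul_basePoint {A : GL (Fin 2) K}
    (h : ∀ i, A • basePoint K i = basePoint K i) : Matrix.ProjGenLinGroup.mk A = 1 := by
  have h₁₀ : A 1 0 = 0 := OnePoint.smul_infty_eq_self_iff.1 (h 0)
  have hdet := A.det_ne_zero
  rw [Matrix.det_fin_two, h₁₀, mul_zero, sub_zero] at hdet
  have h₀₀ : A 0 0 ≠ 0 := left_ne_zero_of_mul hdet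
  have h₁₁ : A 1 1 ≠ 0 := right_ne_zero_of_mul hdet
  have h₀₁ : A 0 1 = 0 := by
    simpa [basePoint, OnePoint.smul_some_eq_ite, h₁₀, h₁₁] using h 1
  have hdiag : A 0 0 = A 1 1 := by
    simpa [basePoint, OnePoint.smul_some_eq_ite, h₁₀, h₁₁, h₀₁, div_eq_one_iff_eq] using h 2
  have hA : A = Matrix.GeneralLinearGroup.scalar (Fin 2) (Units.mk0 _ h₀₀) := by
    ext i j
    fin_cases i <;> fin_cases j <;> simp [h₁₀, h₀₁, hdiag]
  rw [hA, Matrix.ProjGenLinGroup.mk_scalar]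

end Projective

section Semilinear

variable {p m : ℕ} [Fact p.Prime] {K : Type*} [Field K] (hK : Nat.card K = (p ^ m) ^ 2)

/-- The field automorphism `β` attached to a determinant: trivial on squares, `α` on non-squares. -/
noncomputable def twist : Kˣ →* RingAut K :=
  haveI := finite_of_card hK
  nonsquareHom (conj hK) (RingEquiv.ext (conj_conj hK))

theorem twist_of_isSquare {u : Kˣ} (hu : IsSquare u) : twist hK u = 1 := if_pos hu

theorem twist_of_not_isSquare {u : Kˣ} (hu : ¬ IsSquare u) : twist hK u = conj hK := if_neg hu

theorem twist_mul_self (u : Kˣ) : twist hK u * twist hK u = 1 := by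
  rw [← map_mul, twist_of_isSquare hK ⟨u, rfl⟩]

theorem twist_inv (u : Kˣ) : twist hK u⁻¹ = twist hK u := by
  rw [map_inv, inv_eq_of_mul_eq_one_left (twist_mul_self hK u)]

theorem twist_twist (u : Kˣ) (x : K) : twist hK u (twist hK u x) = x :=
  RingEquiv.congr_fun (twist_mul_self hK u) x

theorem twist_map (σ : RingAut K) (u : Kˣ) :
    twist hK (Units.map ((σ : K →+* K) : K →* K) u) = twist hK u := by
  have hsq : IsSquare (Units.map ((σ : K →+* K) : K →* K) u) ↔ IsSquare u := by
    refine ⟨fun h => ?_, fun h => h.map _⟩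
    exact (Units.mapEquiv (σ : K ≃* K)).symm_apply_apply u ▸
      h.map (Units.mapEquiv (σ : K ≃* K)).symm
  by_cases hu : IsSquare u
  · rw [twist_of_isSquare hK hu, twist_of_isSquare hK (hsq.2 hu)]
  · rw [twist_of_not_isSquare hK hu, twist_of_not_isSquare hK (mt hsq.1 hu)]

include hK in
theorem isSquare_neg_one_of_card : IsSquare (-1 : Kˣ) := by
  have := finite_of_card hK
  let _ := Fintype.ofFinite K
  have h : IsSquare (-1 : K) := by
    rw [FiniteField.isSquare_neg_one_iff, ← Nat.card_eq_fintype_card, hK]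
    intro h
    have h4 := Nat.pow_mod (p ^ m) 2 4
    have : p ^ m % 4 < 4 := Nat.mod_lt _ (by norm_num)
    interval_cases p ^ m % 4 <;> omega
  obtain ⟨r, hr⟩ := h
  have hr0 : r ≠ 0 := by rintro rfl; simp at hr
  exact ⟨Units.mk0 r hr0, by ext; simpa using hr⟩

theorem twist_neg_one : twist hK (-1) = 1 := twist_of_isSquare hK (isSquare_neg_one_of_card hK)

/-- The field automorphism `β` attached to an element of `PGL₂(K)` through its determinant. -/
noncomputable def pglTwist : PGL(2, K) →* RingAut K :=
  QuotientGroup.lift (Subgroup.center (GL (Fin 2) K))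
    ((twist hK).comp Matrix.GeneralLinearGroup.det) (by
      rw [Matrix.GeneralLinearGroup.center_eq_range_scalar]
      rintro _ ⟨u, rfl⟩
      exact twist_of_isSquare hK ⟨u, Units.ext (by simp [sq])⟩)

theorem pglTwist_mk (A : GL (Fin 2) K) :
    pglTwist hK (Matrix.ProjGenLinGroup.mk A) = twist hK (Matrix.GeneralLinearGroup.det A) := rfl

theorem phiBar_inv_apply_mk (g : PGL(2, K)) (B : GL (Fin 2) K) :
    (phiBar hK g)⁻¹ (Matrix.ProjGenLinGroup.mk B) =
      Matrix.ProjGenLinGroup.mk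
        (Matrix.GeneralLinearGroup.map (pglTwist hK g : K →+* K) B) := by
  induction g using Matrix.ProjGenLinGroup.induction_on with
  | mk A =>
    by_cases hA : IsSquare (Matrix.GeneralLinearGroup.det A)
    · rw [phiBar_mk, if_pos hA, inv_one, MulAut.one_apply, pglTwist_mk, twist_of_isSquare hK hA]
      rfl
    · rw [phiBar_mk, if_neg hA, inv_eq_of_mul_eq_one_left (conjPGL_mul_self hK), conjPGL_mk,
        pglTwist_mk, twist_of_not_isSquare hK hA, conjGL_apply]

open scoped Classical in
/-- The action of the deformation of `PGL₂(K)` on the projective line by semilinear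
transformations. -/
noncomputable def semiMoebiusHom : Deformation (phiBar hK) →* Equiv.Perm (OnePoint K) :=
  Deformation.lift (moebiusPerm K) ((autPerm K).comp (pglTwist hK))
    (by
      rintro g y
      induction y using Matrix.ProjGenLinGroup.induction_on with
      | mk B => rw [phiBar_inv_apply_mk, MonoidHom.comp_apply, autPerm_mul_moebiusPerm])
    (by
      rintro g y
      induction y using Matrix.ProjGenLinGroup.induction_on with
      | mk B =>
        rw [phiBar_inv_apply_mk, MonoidHom.comp_apply, MonoidHom.comp_apply, pglTwist_mk,
          pglTwist_mk, Matrix.GeneralLinearGroup.map_det, twist_map])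

/-- The permutation `ω ↦ (a β(ω) + b) / (c β(ω) + d)` of the projective line. -/
noncomputable def semiPerm (A : GL (Fin 2) K) : Equiv.Perm (OnePoint K) :=
  semiMoebiusHom hK (Deformation.of _ (Matrix.ProjGenLinGroup.mk A))

open scoped Classical in
theorem semiPerm_apply (A : GL (Fin 2) K) (ω : OnePoint K) :
    semiPerm hK A ω = A • OnePoint.map (twist hK (Matrix.GeneralLinearGroup.det A)) ω := rfl

theorem semiPerm_eq_semiMoebius (A : GL (Fin 2) K) (ω : OnePoint K) :
    semiPerm hK A ω = semiMoebius hK A ω := by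
  classical
  rw [semiPerm_apply, semiMoebius, beta]
  split_ifs with hA
  · rw [twist_of_isSquare hK hA]
    exact congrArg (A • ·) (congrFun OnePoint.map_id ω)
  · rw [twist_of_not_isSquare hK hA]

theorem semiPerm_mem_M (A : GL (Fin 2) K) : semiPerm hK A ∈ M hK :=
  ⟨A, semiPerm_eq_semiMoebius hK A⟩

theorem semiMoebiusHom_range : (semiMoebiusHom hK).range = M hK := by
  ext g
  constructor
  · rintro ⟨⟨x⟩, rfl⟩
    induction x using Matrix.ProjGenLinGroup.induction_on with
    | mk A => exact semiPerm_mem_M hK A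
  · rintro ⟨A, hA⟩
    exact ⟨Deformation.of _ (Matrix.ProjGenLinGroup.mk A),
      Equiv.ext fun ω => (semiPerm_eq_semiMoebius hK A ω).trans (hA ω).symm⟩

theorem eq_one_of_semiMoebiusHom_basePoint {x : Deformation (phiBar hK)}
    (hx : ∀ i, semiMoebiusHom hK x (basePoint K i) = basePoint K i) : x = 1 := by
  classical
  obtain ⟨x⟩ := x
  induction x using Matrix.ProjGenLinGroup.induction_on with
  | mk A =>
    refine Deformation.ext (mk_eq_one_of_smul_basePoint fun i => ?_)
    have hβ : OnePoint.map (twist hK (Matrix.GeneralLinearGroup.det A)) (basePoint K i) =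
        basePoint K i := by
      fin_cases i <;> simp [basePoint]
    calc A • basePoint K i = semiPerm hK A (basePoint K i) := by rw [semiPerm_apply, hβ]
      _ = basePoint K i := hx i

theorem semiMoebiusHom_injective : Function.Injective (semiMoebiusHom hK) :=
  (injective_iff_map_eq_one _).2 fun _ hx =>
    eq_one_of_semiMoebiusHom_basePoint hK fun _ => by rw [hx, Equiv.Perm.one_apply]

theorem eq_one_of_mem_M_of_basePoint {g : Equiv.Perm (OnePoint K)} (hg : g ∈ M hK)
    (hfix : ∀ i, g (basePoint K i) = basePoint K i) : g = 1 := by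
  rw [← semiMoebiusHom_range] at hg
  obtain ⟨x, rfl⟩ := hg
  rw [eq_one_of_semiMoebiusHom_basePoint hK hfix, map_one]

theorem eq_of_mem_M {f g : Equiv.Perm (OnePoint K)} (hf : f ∈ M hK) (hg : g ∈ M hK)
    (h : f ∞ = g ∞) (h₀ : f (0 : K) = g (0 : K)) (h₁ : f (1 : K) = g (1 : K)) : f = g := by
  refine (inv_mul_eq_one.1 (eq_one_of_mem_M_of_basePoint hK
    ((M hK).mul_mem ((M hK).inv_mem hg) hf) fun i => ?_)).symm
  rw [Equiv.Perm.mul_apply, Equiv.Perm.inv_eq_iff_eq]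
  fin_cases i
  exacts [h, h₀, h₁]

/-- The isomorphism of the deformation of `PGL₂(K)` onto `M(q²)`. -/
noncomputable def deformationEquiv : Deformation (phiBar hK) ≃* M hK :=
  (MonoidHom.ofInjective (semiMoebiusHom_injective hK)).trans
    (MulEquiv.subgroupCongr (semiMoebiusHom_range hK))

theorem coe_deformationEquiv_mk (A : GL (Fin 2) K) :
    (deformationEquiv hK (Deformation.of _ (Matrix.ProjGenLinGroup.mk A)) :
      Equiv.Perm (OnePoint K)) = semiPerm hK A := rfl

end Semilinear

/-! ### The standard transformations -/

section StandardTransformations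

variable {p m : ℕ} [Fact p.Prime] {K : Type*} [Field K] (hK : Nat.card K = (p ^ m) ^ 2)

theorem det_matR (u : Kˣ) : Matrix.GeneralLinearGroup.det (matR u) = u := by
  ext
  simp [matR, Matrix.GeneralLinearGroup.mkOfDetNeZero]

theorem det_matT : Matrix.GeneralLinearGroup.det (matT K) = -1 := by
  ext
  simp [matT, Matrix.GeneralLinearGroup.mkOfDetNeZero]

theorem det_matJ : Matrix.GeneralLinearGroup.det (matJ K) = -1 := by
  ext
  simp [matJ, Matrix.GeneralLinearGroup.mkOfDetNeZero]

theorem semiPerm_matR_infty (u : Kˣ) : semiPerm hK (matR u) ∞ = ∞ := by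
  classical
  exact (semiPerm_apply hK _ _).trans (OnePoint.smul_infty_eq_self_iff.2 rfl)

theorem semiPerm_matR_coe (u : Kˣ) (x : K) :
    semiPerm hK (matR u) x = (u * twist hK u x : K) := by
  classical
  rw [semiPerm_apply, det_matR, OnePoint.map_some, OnePoint.smul_some_eq_ite]
  simp [matR, Matrix.GeneralLinearGroup.mkOfDetNeZero]

theorem semiPerm_matR_zero (u : Kˣ) : semiPerm hK (matR u) (0 : K) = (0 : K) := by
  rw [semiPerm_matR_coe, map_zero, mul_zero]

theorem semiPerm_matR_one (u : Kˣ) : semiPerm hK (matR u) (1 : K) = (u : K) := by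
  rw [semiPerm_matR_coe, map_one, mul_one]

theorem semiPerm_matT_infty : semiPerm hK (matT K) ∞ = ∞ := by
  classical
  exact (semiPerm_apply hK _ _).trans (OnePoint.smul_infty_eq_self_iff.2 rfl)

theorem semiPerm_matT_coe (x : K) : semiPerm hK (matT K) x = (1 - x : K) := by
  classical
  rw [semiPerm_apply, det_matT, twist_neg_one, OnePoint.map_some, OnePoint.smul_some_eq_ite]
  simp [matT, Matrix.GeneralLinearGroup.mkOfDetNeZero, div_neg, sub_eq_add_neg, add_comm]

theorem semiPerm_matJ_infty : semiPerm hK (matJ K) ∞ = (0 : K) := by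
  classical
  rw [semiPerm_apply, OnePoint.map_infty, OnePoint.smul_infty_eq_ite]
  simp [matJ, Matrix.GeneralLinearGroup.mkOfDetNeZero]

theorem semiPerm_matJ_zero : semiPerm hK (matJ K) (0 : K) = ∞ := by
  classical
  rw [semiPerm_apply, OnePoint.map_some, OnePoint.smul_some_eq_ite]
  simp [matJ, Matrix.GeneralLinearGroup.mkOfDetNeZero]

theorem semiPerm_matJ_unit (u : Kˣ) : semiPerm hK (matJ K) (u : K) = ((u⁻¹ : Kˣ) : K) := by
  classical
  rw [semiPerm_apply, det_matJ, twist_neg_one, OnePoint.map_some, OnePoint.smul_some_eq_ite]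
  simp [matJ, Matrix.GeneralLinearGroup.mkOfDetNeZero, neg_div]

theorem semiPerm_matJ_one : semiPerm hK (matJ K) (1 : K) = (1 : K) := by
  simpa using semiPerm_matJ_unit hK 1

theorem exists_semiPerm_matR_eq_one {x : K} (hx : x ≠ 0) :
    ∃ u, semiPerm hK (matR u) x = (1 : K) := by
  lift x to Kˣ using hx.isUnit
  refine ⟨(Units.map ((twist hK x : K →+* K) : K →* K) x)⁻¹, ?_⟩
  rw [semiPerm_matR_coe, twist_inv, twist_map]
  exact congrArg _ (Units.inv_mul (Units.map ((twist hK x : K →+* K) : K →* K) x))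

theorem exists_mem_map_basePoint {N : Subgroup (Equiv.Perm (OnePoint K))}
    (hR : ∀ u, semiPerm hK (matR u) ∈ N) (hT : semiPerm hK (matT K) ∈ N)
    (hJ : semiPerm hK (matJ K) ∈ N) (x : Fin 3 → OnePoint K) (hx : Function.Injective x) :
    ∃ g ∈ N, ∀ i, g (x i) = basePoint K i := by
  refine exists_mem_map_base hT hJ (semiPerm_matT_infty hK) ?_ (semiPerm_matJ_zero hK) ?_ hx
  · rw [semiPerm_matT_coe, sub_self]
  · intro y hy hy₀
    obtain ⟨y, rfl⟩ := OnePoint.ne_infty_iff_exists.1 hy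
    obtain ⟨u, hu⟩ := exists_semiPerm_matR_eq_one hK (x := y) fun h => hy₀ (by rw [h])
    exact ⟨_, hR u, semiPerm_matR_infty hK u, semiPerm_matR_zero hK u, hu⟩

theorem isSharplyThreeTransitive_M : IsSharplyThreeTransitive (M hK) :=
  isSharplyThreeTransitive_of_base
    (exists_mem_map_basePoint hK (fun _ => semiPerm_mem_M hK _) (semiPerm_mem_M hK _)
      (semiPerm_mem_M hK _))
    (fun _ => eq_one_of_mem_M_of_basePoint hK)

theorem eq_M_of_standard_mem {N : Subgroup (Equiv.Perm (OnePoint K))} (hN : N ≤ M hK)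
    (hR : ∀ u, semiPerm hK (matR u) ∈ N) (hT : semiPerm hK (matT K) ∈ N)
    (hJ : semiPerm hK (matJ K) ∈ N) : N = M hK :=
  eq_of_le_of_base basePoint_injective hN (exists_mem_map_basePoint hK hR hT hJ)
    (fun _ => eq_one_of_mem_M_of_basePoint hK)

theorem semiPerm_mul_mem_M (A B : GL (Fin 2) K) : semiPerm hK A * semiPerm hK B ∈ M hK :=
  (M hK).mul_mem (semiPerm_mem_M hK A) (semiPerm_mem_M hK B)

theorem semiPerm_mul_mul_mem_M (A B C : GL (Fin 2) K) :
    semiPerm hK A * semiPerm hK B * semiPerm hK C ∈ M hK :=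
  (M hK).mul_mem (semiPerm_mul_mem_M hK A B) (semiPerm_mem_M hK C)

theorem semiPerm_matR_mul (u v : Kˣ) :
    semiPerm hK (matR u) * semiPerm hK (matR v) =
      semiPerm hK (matR (u * Units.map ((twist hK u : K →+* K) : K →* K) v)) := by
  refine eq_of_mem_M hK (semiPerm_mul_mem_M hK _ _) (semiPerm_mem_M hK _) ?_ ?_ ?_
  · simp only [Equiv.Perm.mul_apply, semiPerm_matR_infty]
  · simp only [Equiv.Perm.mul_apply, semiPerm_matR_zero]
  · rw [Equiv.Perm.mul_apply, semiPerm_matR_one, semiPerm_matR_one, semiPerm_matR_coe]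
    rfl

theorem semiPerm_matT_sq : semiPerm hK (matT K) * semiPerm hK (matT K) = 1 := by
  refine eq_of_mem_M hK (semiPerm_mul_mem_M hK _ _) (M hK).one_mem ?_ ?_ ?_ <;>
    simp [semiPerm_matT_infty, semiPerm_matT_coe]

theorem semiPerm_matJ_sq : semiPerm hK (matJ K) * semiPerm hK (matJ K) = 1 := by
  refine eq_of_mem_M hK (semiPerm_mul_mem_M hK _ _) (M hK).one_mem ?_ ?_ ?_ <;>
    simp [semiPerm_matJ_infty, semiPerm_matJ_zero, semiPerm_matJ_one]

theorem semiPerm_matJ_conj_matR (u : Kˣ) :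
    semiPerm hK (matJ K) * semiPerm hK (matR u) * semiPerm hK (matJ K) =
      semiPerm hK (matR u⁻¹) := by
  refine eq_of_mem_M hK (semiPerm_mul_mul_mem_M hK _ _ _) (semiPerm_mem_M hK _) ?_ ?_ ?_ <;>
    simp only [Equiv.Perm.mul_apply, semiPerm_matJ_infty, semiPerm_matJ_zero, semiPerm_matJ_one,
    semiPerm_matR_infty, semiPerm_matR_zero, semiPerm_matR_one, semiPerm_matJ_unit]

theorem semiPerm_braid :
    semiPerm hK (matJ K) * semiPerm hK (matT K) * semiPerm hK (matJ K) =
      semiPerm hK (matT K) * semiPerm hK (matJ K) * semiPerm hK (matT K) := by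
  refine eq_of_mem_M hK (semiPerm_mul_mul_mem_M hK _ _ _) (semiPerm_mul_mul_mem_M hK _ _ _)
    ?_ ?_ ?_ <;>
    simp [semiPerm_matJ_infty, semiPerm_matJ_zero, semiPerm_matJ_one, semiPerm_matT_infty,
    semiPerm_matT_coe]

theorem semiPerm_matT_conj_matR {u w : Kˣ} (huw : (1 : K) - u = w) :
    semiPerm hK (matT K) * semiPerm hK (matR u) * semiPerm hK (matT K) =
      semiPerm hK (matR w) * semiPerm hK (matT K) * semiPerm hK
        (matR (Units.map ((twist hK w : K →+* K) : K →* K) (-u * w⁻¹))) := by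
  refine eq_of_mem_M hK (semiPerm_mul_mul_mem_M hK _ _ _) (semiPerm_mul_mul_mem_M hK _ _ _)
    ?_ ?_ ?_ <;>
    simp only [Equiv.Perm.mul_apply, semiPerm_matT_infty, semiPerm_matR_infty,
      semiPerm_matT_coe, semiPerm_matR_zero, semiPerm_matR_one, sub_zero, sub_self, huw]
  have htwist : twist hK w (1 - twist hK w ((-u * w⁻¹ : Kˣ) : K)) = 1 + u * (w : K)⁻¹ := by
    rw [map_sub, map_one, twist_twist]
    push_cast
    ring
  have hw : (w : K) * (1 + u * (w : K)⁻¹) = 1 := by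
    rw [mul_add, mul_left_comm, mul_inv_cancel₀ w.ne_zero, ← huw]
    ring
  rw [semiPerm_matR_coe]
  exact congrArg _ (hw.symm.trans (congrArg ((w : K) * ·) htwist.symm))

end StandardTransformations

/-! ### Words in the torus -/

section TorusWords

variable {G : Type*} [Group G] {h : ℤ} {a b J : G}

/-- The group element spelled by the word `[J, a] ^ ⌈e / 2⌉ * a ^ (e - 2 ⌊e / 2⌋)`, where `b` stands
for `[J, a]`; it is meant to be the element `R(ζ ^ e)` of the torus. -/
def torusElt (b a : G) (e : ℤ) : G := b ^ ((e + 1) / 2) * a ^ (e % 2)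

/-- The factor by which `R(ζ ^ e)` scales exponents of `ζ`: `1` if `ζ ^ e` is a square and `q`,
the effect of the Frobenius automorphism `x ↦ x ^ q`, otherwise. -/
def parityScale (q e : ℤ) : ℤ := if Even e then 1 else q

theorem parityScale_even (q i : ℤ) : parityScale q (2 * i) = 1 := if_pos (even_two_mul i)

theorem parityScale_odd (q i : ℤ) : parityScale q (2 * i + 1) = q :=
  if_neg (Int.not_even_two_mul_add_one i)

theorem torusElt_even (b a : G) (i : ℤ) : torusElt b a (2 * i) = b ^ i := by
  have hdiv : (2 * i + 1) / 2 = i := by lia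
  have hmod : 2 * i % 2 = 0 := by lia
  rw [torusElt, hdiv, hmod, zpow_zero, mul_one]

theorem torusElt_odd (b a : G) (i : ℤ) : torusElt b a (2 * i + 1) = b ^ (i + 1) * a := by
  have hdiv : (2 * i + 1 + 1) / 2 = i + 1 := by lia
  have hmod : (2 * i + 1) % 2 = 1 := by lia
  rw [torusElt, hdiv, hmod, zpow_one]

theorem torusElt_zero (b a : G) : torusElt b a 0 = 1 := by
  simpa only [mul_zero, zpow_zero] using torusElt_even b a 0

theorem torusElt_neg_one (b a : G) : torusElt b a (-1) = a := by
  simpa using torusElt_odd b a (-1)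

theorem torusElt_even_mul (b a : G) (i f : ℤ) :
    torusElt b a (2 * i) * torusElt b a f = torusElt b a (2 * i + f) := by
  rw [torusElt_even]
  obtain ⟨j, rfl | rfl⟩ := Int.even_or_odd' f
  · rw [torusElt_even, ← mul_add, torusElt_even, zpow_add]
  · rw [torusElt_odd, ← add_assoc, ← mul_add, torusElt_odd, ← mul_assoc, ← zpow_add, add_assoc]

theorem J_mul_torusElt_mul_J (hJ : J * J = 1) (hb : J * b * J = b⁻¹) (ha : J * a * J = b * a)
    (e : ℤ) : J * torusElt b a e * J = torusElt b a (-e) := by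
  have hJinv : J⁻¹ = J := inv_eq_of_mul_eq_one_left hJ
  have hpow (i : ℤ) : J * b ^ i * J = b ^ (-i) := by
    simpa only [hJinv, hb, inv_zpow'] using (conj_zpow (i := i) (a := J) (b := b)).symm
  obtain ⟨i, rfl | rfl⟩ := Int.even_or_odd' e
  · rw [← mul_neg, torusElt_even, torusElt_even, hpow]
  · calc J * torusElt b a (2 * i + 1) * J = J * b ^ (i + 1) * (J * J) * a * J := by
          rw [torusElt_odd, hJ, mul_one, ← mul_assoc]
      _ = (J * b ^ (i + 1) * J) * (J * a * J) := by simp only [mul_assoc]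
      _ = b ^ (-(i + 1) + 1) * a := by rw [hpow, ha, ← mul_assoc, zpow_add_one]
      _ = torusElt b a (-(2 * i + 1)) := by
          rw [← torusElt_odd]
          congr 1
          ring

/-- The relations of the presentation that involve `b = [J, a]` and `a` only, for `q = 2 h + 1`. -/
structure TorusRelations (h : ℤ) (b a : G) : Prop where
  b_pow : b ^ (2 * h * (h + 1)) = 1
  a_sq : a * a = b ^ (-(h + 1))
  a_mul_b : a * b = b ^ (2 * h + 1) * a

namespace TorusRelations

theorem a_mul_zpow (hR : TorusRelations h b a) (n : ℤ) :
    a * b ^ n = b ^ ((2 * h + 1) * n) * a := by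
  have hconj : a * b * a⁻¹ = b ^ (2 * h + 1) := by rw [hR.a_mul_b, mul_inv_cancel_right]
  rw [zpow_mul, ← hconj, conj_zpow, inv_mul_cancel_right]

theorem torusElt_odd_mul (hR : TorusRelations h b a) (i f : ℤ) :
    torusElt b a (2 * i + 1) * torusElt b a f =
      torusElt b a (2 * i + 1 + (2 * h + 1) * f) := by
  obtain ⟨j, rfl | rfl⟩ := Int.even_or_odd' f
  · calc torusElt b a (2 * i + 1) * torusElt b a (2 * j)
        = b ^ (i + 1 + (2 * h + 1) * j) * a := by
          rw [torusElt_odd, torusElt_even, mul_assoc, hR.a_mul_zpow, ← mul_assoc, ← zpow_add]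
      _ = torusElt b a (2 * (i + (2 * h + 1) * j) + 1) := by rw [torusElt_odd, add_right_comm]
      _ = _ := by congr 1; ring
  · calc torusElt b a (2 * i + 1) * torusElt b a (2 * j + 1)
        = b ^ (i + 1) * (a * b ^ (j + 1)) * a := by
          simp only [torusElt_odd, mul_assoc]
      _ = b ^ (i + 1 + (2 * h + 1) * (j + 1) + -(h + 1)) := by
          rw [hR.a_mul_zpow, ← mul_assoc, mul_assoc, hR.a_sq, zpow_add _ _ (-(h + 1)),
            zpow_add _ (i + 1)]
      _ = torusElt b a (2 * i + 1 + (2 * h + 1) * (2 * j + 1)) := by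
          rw [← torusElt_even b a]
          congr 1
          ring

theorem torusElt_mul (hR : TorusRelations h b a) (e f : ℤ) :
    torusElt b a e * torusElt b a f = torusElt b a (e + parityScale (2 * h + 1) e * f) := by
  obtain ⟨i, rfl | rfl⟩ := Int.even_or_odd' e
  · rw [parityScale_even, one_mul, torusElt_even_mul]
  · rw [parityScale_odd, hR.torusElt_odd_mul]

theorem torusElt_of_dvd (hR : TorusRelations h b a) {e : ℤ} (he : 4 * h * (h + 1) ∣ e) :
    torusElt b a e = 1 := by
  obtain ⟨n, rfl⟩ := he
  rw [show 4 * h * (h + 1) * n = 2 * (2 * h * (h + 1) * n) by ring, torusElt_even, zpow_mul,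
    hR.b_pow, one_zpow]

theorem torusElt_emod (hR : TorusRelations h b a) (e : ℤ) :
    torusElt b a (e % (4 * h * (h + 1))) = torusElt b a e := by
  have hquot : 4 * h * (h + 1) * (e / (4 * h * (h + 1))) =
      2 * (2 * h * (h + 1) * (e / (4 * h * (h + 1)))) := by ring
  conv_rhs => rw [← Int.mul_ediv_add_emod e (4 * h * (h + 1)), hquot, ← torusElt_even_mul, ← hquot,
    hR.torusElt_of_dvd (dvd_mul_right _ _), one_mul]

theorem torusElt_inv (hR : TorusRelations h b a) (e : ℤ) :
    (torusElt b a e)⁻¹ = torusElt b a (-(parityScale (2 * h + 1) e * e)) := by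
  refine inv_eq_of_mul_eq_one_right ?_
  rw [hR.torusElt_mul]
  refine hR.torusElt_of_dvd ?_
  obtain ⟨i, rfl | rfl⟩ := Int.even_or_odd' e
  · rw [parityScale_even]
    exact ⟨0, by ring⟩
  · rw [parityScale_odd]
    exact ⟨-(2 * i + 1), by ring⟩

/-- The subgroup generated by `b = [J, a]` and `a`; it consists of the elements
`torusElt b a e`, which are meant to be the `R(ζ ^ e)`. -/
def torus (hR : TorusRelations h b a) : Subgroup G where
  carrier := Set.range (torusElt b a)
  one_mem' := ⟨0, torusElt_zero b a⟩
  mul_mem' := by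
    rintro _ _ ⟨e, rfl⟩ ⟨f, rfl⟩
    exact ⟨_, (hR.torusElt_mul e f).symm⟩
  inv_mem' := by
    rintro _ ⟨e, rfl⟩
    exact ⟨_, (hR.torusElt_inv e).symm⟩

end TorusRelations

section OfMul

variable {r : ℤ → G} (hr : ∀ e f, r e * r f = r (e + parityScale (2 * h + 1) e * f))

include hr

theorem zpow_of_parityScale_mul (n : ℤ) : r 2 ^ n = r (2 * n) := by
  have hstep (i : ℤ) : r (2 * i) * r 2 = r (2 * (i + 1)) := by
    rw [hr, parityScale_even, one_mul, mul_add, mul_one]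
  induction n using Int.induction_on with
  | zero =>
    have hzero : r 0 * r 0 = r 0 := by rw [hr, mul_zero, add_zero]
    rw [zpow_zero, mul_zero, left_eq_mul.1 hzero.symm]
  | succ n ih => rw [zpow_add_one, ih, hstep]
  | pred n ih => rw [zpow_sub_one, ih, mul_inv_eq_iff_eq_mul, hstep, sub_add_cancel]

theorem torusElt_of_parityScale_mul (e : ℤ) : torusElt (r 2) (r (-1)) e = r e := by
  obtain ⟨i, rfl | rfl⟩ := Int.even_or_odd' e
  · rw [torusElt_even, zpow_of_parityScale_mul hr]
  · rw [torusElt_odd, zpow_of_parityScale_mul hr, hr, parityScale_even]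
    congr 1
    ring

theorem torusRelations_of_parityScale_mul (hper : r (4 * h * (h + 1)) = 1) :
    TorusRelations h (r 2) (r (-1)) where
  b_pow := by
    rw [zpow_of_parityScale_mul hr, ← hper]
    congr 1
    ring
  a_sq := by
    rw [zpow_of_parityScale_mul hr, hr, show (-1 : ℤ) = 2 * (-1) + 1 from rfl, parityScale_odd]
    congr 1
    ring
  a_mul_b := by
    rw [zpow_of_parityScale_mul hr, hr, hr, parityScale_even,
      show (-1 : ℤ) = 2 * (-1) + 1 from rfl, parityScale_odd]
    congr 1
    ring

end OfMul

end TorusWords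

/-! ### The relations in an arbitrary group -/

section Relators

variable {G : Type*} [Group G] {q h : ℕ} {K : Type*} [Field K] {ζ : Kˣ}

/-- The relations of the presentation for `q = 2 h + 1`, rewritten so that `R(ζ ^ j)` is
`torusElt ⁅J, a⁆ a j` and both cases of the relation for `T R(ζ ^ j) T` are one;
`(J [J, a]) ^ 2 = 1` is a consequence of `J ^ 2 = 1`. -/
structure SatisfiesRelations (h : ℕ) (ζ : Kˣ) (a T J : G) : Prop where
  torusRelations : TorusRelations (h : ℤ) ⁅J, a⁆ a
  T_sq : T * T = 1
  J_sq : J * J = 1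
  braid : J * T * J = T * J * T
  T_conj : ∀ j k : ℕ, 1 ≤ j → j < 4 * h * (h + 1) → 1 ≤ k → k < 4 * h * (h + 1) →
    1 - (ζ : K) ^ j = (ζ : K) ^ k →
    T * torusElt ⁅J, a⁆ a j * T = torusElt ⁅J, a⁆ a k * T *
      torusElt ⁅J, a⁆ a (2 * h * (h + 1) + parityScale (2 * h + 1) k * (j - k))

theorem mul_commutatorElement_mul {J : G} (hJ : J * J = 1) (a : G) :
    J * ⁅J, a⁆ * J = ⁅J, a⁆⁻¹ := by
  rw [commutatorElement_inv, commutatorElement_def, commutatorElement_def,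
    inv_eq_of_mul_eq_one_left hJ]
  simp only [← mul_assoc, hJ, one_mul]

theorem sq_sub_one (hq : q = 2 * h + 1) : q ^ 2 - 1 = 4 * h * (h + 1) := by
  rw [hq, show (2 * h + 1) ^ 2 = 4 * h * (h + 1) + 1 by ring, Nat.add_sub_cancel]

theorem intCast_sq_sub_one (hq : q = 2 * h + 1) : (q : ℤ) ^ 2 - 1 = 4 * h * (h + 1) := by
  rw [hq]
  push_cast
  ring

theorem map_wb (f : FreeGroup Gen →* G) : f wb = ⁅f wJ, f wa⁆ := by
  simp only [wb, map_mul, map_inv, commutatorElement_def]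

theorem map_wR (f : FreeGroup Gen →* G) (k : ℕ) : f (wR k) = torusElt ⁅f wJ, f wa⁆ (f wa) k := by
  have hdiv : (((k + 1) / 2 : ℕ) : ℤ) = ((k : ℤ) + 1) / 2 := by lia
  have hmod : ((k - 2 * (k / 2) : ℕ) : ℤ) = (k : ℤ) % 2 := by lia
  rw [wR, map_mul, map_pow, map_pow, map_wb, torusElt, ← hdiv, ← hmod, zpow_natCast,
    zpow_natCast]

theorem TorusRelations.map_wRζ {f : FreeGroup Gen →* G}
    (hR : TorusRelations (h : ℤ) ⁅f wJ, f wa⁆ (f wa)) (hq : q = 2 * h + 1) (hh : 0 < h) (e : ℤ) :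
    f (wRζ q e) = torusElt ⁅f wJ, f wa⁆ (f wa) e := by
  have hpos : (0 : ℤ) < 4 * h * (h + 1) := by positivity
  rw [wRζ, map_wR, intCast_sq_sub_one hq, Int.toNat_of_nonneg (Int.emod_nonneg _ hpos.ne'),
    hR.torusElt_emod]

theorem torusRelations_map_iff (hq : q = 2 * h + 1) (f : FreeGroup Gen →* G) :
    TorusRelations (h : ℤ) ⁅f wJ, f wa⁆ (f wa) ↔
      f (wb ^ ((q ^ 2 - 1) / 2)) = 1 ∧ f (wa ^ 2 * (wb⁻¹ ^ ((q + 1) / 2))⁻¹) = 1 ∧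
        f ((wb⁻¹ * wa * wb) * (wb ^ (q - 1) * wa)⁻¹) = 1 := by
  have hord : (q ^ 2 - 1) / 2 = 2 * h * (h + 1) := by
    rw [sq_sub_one hq, show 4 * h * (h + 1) = 2 * (2 * h * (h + 1)) by ring]
    lia
  have hhalf : (q + 1) / 2 = h + 1 := by lia
  have hpred : q - 1 = 2 * h := by lia
  have hpow : f (wb ^ ((q ^ 2 - 1) / 2)) = 1 ↔ f wb ^ (2 * (h : ℤ) * (h + 1)) = 1 := by
    rw [map_pow, hord]
    norm_cast
  have hsq : f (wa ^ 2 * (wb⁻¹ ^ ((q + 1) / 2))⁻¹) = 1 ↔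
      f wa * f wa = f wb ^ (-((h : ℤ) + 1)) := by
    rw [map_mul, map_inv, mul_inv_eq_one, map_pow, map_pow, map_inv, hhalf, sq, inv_pow, zpow_neg]
    norm_cast
  have hconj : f ((wb⁻¹ * wa * wb) * (wb ^ (q - 1) * wa)⁻¹) = 1 ↔
      f wa * f wb = f wb ^ (2 * (h : ℤ) + 1) * f wa := by
    rw [map_mul, map_inv, mul_inv_eq_one, hpred, map_mul, map_mul, map_mul, map_inv, map_pow,
      mul_assoc, inv_mul_eq_iff_eq_mul, ← mul_assoc, ← pow_succ']
    norm_cast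
  rw [hpow, hsq, hconj, map_wb]
  exact ⟨fun hR => ⟨hR.1, hR.2, hR.3⟩, fun hR => ⟨hR.1, hR.2.1, hR.2.2⟩⟩

theorem mul_pow_three_eq_one_iff {T J : G} (hT : T * T = 1) (hJ : J * J = 1) :
    (J * T) ^ 3 = 1 ↔ J * T * J = T * J * T := by
  have hTinv : T⁻¹ = T := inv_eq_of_mul_eq_one_left hT
  have hJinv : J⁻¹ = J := inv_eq_of_mul_eq_one_left hJ
  have hcube : (J * T) ^ 3 = J * T * J * (T * J * T) := by
    simp only [pow_succ, pow_zero, one_mul, mul_assoc]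
  rw [hcube, ← eq_inv_iff_mul_eq_one, mul_inv_rev, mul_inv_rev, hTinv, hJinv, mul_assoc T]

theorem TorusRelations.map_T_conj_eq_one_iff {f : FreeGroup Gen →* G}
    (hR : TorusRelations (h : ℤ) ⁅f wJ, f wa⁆ (f wa)) (hq : q = 2 * h + 1) (hh : 0 < h)
    (j k e : ℤ) :
    f (wT * wRζ q j * wT * (wRζ q k * wT * wRζ q e)⁻¹) = 1 ↔
      f wT * torusElt ⁅f wJ, f wa⁆ (f wa) j * f wT =
        torusElt ⁅f wJ, f wa⁆ (f wa) k * f wT * torusElt ⁅f wJ, f wa⁆ (f wa) e := by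
  rw [map_mul, map_inv, mul_inv_eq_one]
  simp only [map_mul, hR.map_wRζ hq hh]

theorem forall_relators_iff (P : FreeGroup Gen → Prop) :
    (∀ r ∈ relators q ζ, P r) ↔
      (P (wb ^ ((q ^ 2 - 1) / 2)) ∧ P (wa ^ 2 * (wb⁻¹ ^ ((q + 1) / 2))⁻¹) ∧
        P ((wb⁻¹ * wa * wb) * (wb ^ (q - 1) * wa)⁻¹)) ∧
      P (wT ^ 2) ∧ P (wJ ^ 2) ∧ P ((wJ * wb) ^ 2) ∧ P ((wJ * wT) ^ 3) ∧
      ∀ j k : ℕ, 1 ≤ j → j < q ^ 2 - 1 → 1 ≤ k → k < q ^ 2 - 1 →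
        1 - (ζ : K) ^ j = (ζ : K) ^ k →
        P (wT * wRζ q j * wT * (wRζ q k * wT *
          wRζ q (((q : ℤ) ^ 2 - 1) / 2 + parityScale q k * (j - k)))⁻¹) := by
  have heven {j k : ℕ} (hk : Even k) : ((q : ℤ) ^ 2 - 1) / 2 - k + j =
      ((q : ℤ) ^ 2 - 1) / 2 + parityScale q k * (j - k) := by
    rw [parityScale, if_pos (by exact_mod_cast hk)]
    ring
  have hodd {j k : ℕ} (hk : ¬ Even k) : ((q : ℤ) ^ 2 - 1) / 2 - q * k + q * j =
      ((q : ℤ) ^ 2 - 1) / 2 + parityScale q k * (j - k) := by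
    rw [parityScale, if_neg (by exact_mod_cast hk)]
    ring
  constructor
  · intro hP
    refine ⟨⟨?_, ?_, ?_⟩, ?_, ?_, ?_, ?_, fun j k hj hj' hk hk' hjk => ?_⟩
    iterate 7 exact hP _ (by simp [relators])
    by_cases hpar : Even k
    · exact hP _ (Or.inl (Or.inr ⟨j, k, hj, hj', hk, hk', hjk, hpar, by rw [heven hpar]⟩))
    · exact hP _ (Or.inr ⟨j, k, hj, hj', hk, hk', hjk, hpar, by rw [hodd hpar]⟩)
  · rintro ⟨⟨hb, ha, hab⟩, hT, hJ, hJb, hJT, hconj⟩ r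
      ((hr | ⟨j, k, hj, hj', hk, hk', hjk, hpar, rfl⟩) | ⟨j, k, hj, hj', hk, hk', hjk, hpar, rfl⟩)
    · obtain rfl | rfl | rfl | rfl | rfl | rfl | rfl := hr <;> assumption
    · simpa only [heven hpar] using hconj j k hj hj' hk hk' hjk
    · simpa only [hodd hpar] using hconj j k hj hj' hk hk' hjk

theorem satisfiesRelations_map_iff (hq : q = 2 * h + 1) (hh : 0 < h) (f : FreeGroup Gen →* G) :
    SatisfiesRelations h ζ (f wa) (f wT) (f wJ) ↔ ∀ r ∈ relators q ζ, f r = 1 := by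
  have hhalf : ((q : ℤ) ^ 2 - 1) / 2 = 2 * h * (h + 1) := by
    rw [intCast_sq_sub_one hq, show 4 * (h : ℤ) * (h + 1) = 2 * (2 * h * (h + 1)) by ring,
      Int.mul_ediv_cancel_left _ two_ne_zero]
  have hqz : (q : ℤ) = 2 * h + 1 := by lia
  have hJb : f wJ * ⁅f wJ, f wa⁆ * f wJ = ⁅f wJ, f wa⁆⁻¹ ↔ f ((wJ * wb) ^ 2) = 1 := by
    rw [eq_inv_iff_mul_eq_one, map_pow, sq, map_mul, map_wb]
    simp only [mul_assoc]
  rw [forall_relators_iff, ← torusRelations_map_iff hq, hhalf, hqz, sq_sub_one hq,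
    map_pow f wT, map_pow f wJ, map_pow f (wJ * wT), map_mul f wJ wT, sq, sq]
  constructor
  · intro hS
    refine ⟨hS.torusRelations, hS.T_sq, hS.J_sq, hJb.1 (mul_commutatorElement_mul hS.J_sq _),
      (mul_pow_three_eq_one_iff hS.T_sq hS.J_sq).2 hS.braid, fun j k hj hj' hk hk' hjk => ?_⟩
    rw [hS.torusRelations.map_T_conj_eq_one_iff hq hh]
    exact hS.T_conj j k hj hj' hk hk' hjk
  · rintro ⟨hR, hT, hJ, -, hJT, hconj⟩
    refine ⟨hR, hT, hJ, (mul_pow_three_eq_one_iff hT hJ).1 hJT,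
      fun j k hj hj' hk hk' hjk => ?_⟩
    have hrel := hconj j k hj hj' hk hk' hjk
    rwa [hR.map_T_conj_eq_one_iff hq hh] at hrel

end Relators

section Generator

theorem isSquare_zpow_iff_even {C : Type*} [Group C] {g : C} (hg : ∀ x, x ∈ Subgroup.zpowers g)
    (hord : Even (orderOf g)) (e : ℤ) : IsSquare (g ^ e) ↔ Even e := by
  refine ⟨?_, fun he => he.isSquare_zpow g⟩
  rintro ⟨r, hr⟩
  obtain ⟨f, rfl⟩ := Subgroup.mem_zpowers_iff.1 (hg r)
  have hdvd : (orderOf g : ℤ) ∣ e - (f + f) :=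
    orderOf_dvd_iff_zpow_eq_one.2 (by rw [zpow_sub, hr, zpow_add, mul_inv_cancel])
  have heven : Even (e - (f + f)) :=
    even_iff_two_dvd.2 ((Int.natCast_dvd_natCast.2 (even_iff_two_dvd.1 hord)).trans hdvd)
  simpa only [sub_add_cancel] using heven.add (Even.add_self f)

variable {K : Type*} [Field K] {ζ : Kˣ}

theorem exists_one_sub_pow_eq_pow (hζ : ∀ x : Kˣ, x ∈ Subgroup.zpowers ζ) {j : ℕ} (hj : 1 ≤ j)
    (hj' : j < orderOf ζ) :
    ∃ k, 1 ≤ k ∧ k < orderOf ζ ∧ 1 - (ζ : K) ^ j = (ζ : K) ^ k := by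
  classical
  have hne : 1 - (ζ : K) ^ j ≠ 0 := by
    rw [sub_ne_zero, ← Units.val_pow_eq_pow_val, ← Units.val_one, Units.val_injective.ne_iff]
    exact (pow_ne_one_of_lt_orderOf (by lia) hj').symm
  have hfin : IsOfFinOrder ζ := orderOf_pos_iff.1 (by lia)
  obtain ⟨k, hk, hpow⟩ := Finset.mem_image.1
    (hfin.mem_zpowers_iff_mem_range_orderOf.1 (hζ (Units.mk0 _ hne)))
  have hpow' : 1 - (ζ : K) ^ j = (ζ : K) ^ k := by
    simpa using (congrArg Units.val hpow).symm
  refine ⟨k, Nat.one_le_iff_ne_zero.2 ?_, Finset.mem_range.1 hk, hpow'⟩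
  rintro rfl
  rw [pow_zero, sub_eq_self] at hpow'
  exact pow_ne_zero j ζ.ne_zero hpow'

theorem pow_eq_neg_one_of_orderOf_eq {n : ℕ} (hn : 0 < n) (hord : orderOf ζ = 2 * n) :
    ζ ^ n = -1 := by
  have hroot : IsPrimitiveRoot (ζ ^ n) 2 :=
    (IsPrimitiveRoot.orderOf ζ).pow (by lia) (by rw [hord, mul_comm])
  exact Units.ext (IsPrimitiveRoot.coe_units_iff.2 hroot).eq_neg_one_of_two_right

theorem orderOf_eq_four_mul {q h : ℕ} (hq : q = 2 * h + 1) (hK : Nat.card K = q ^ 2)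
    (hζ : ∀ x : Kˣ, x ∈ Subgroup.zpowers ζ) : orderOf ζ = 4 * h * (h + 1) := by
  rw [orderOf_eq_card_of_forall_mem_zpowers hζ, Nat.card_units, hK, sq_sub_one hq]

end Generator

namespace SatisfiesRelations

variable {G : Type*} [Group G] {h : ℕ} {K : Type*} [Field K] {ζ : Kˣ} {a T J : G}

theorem J_conj_torusElt (hS : SatisfiesRelations h ζ a T J) (e : ℤ) :
    J * torusElt ⁅J, a⁆ a e * J = torusElt ⁅J, a⁆ a (-e) := by
  refine J_mul_torusElt_mul_J hS.J_sq (mul_commutatorElement_mul hS.J_sq a) ?_ e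
  rw [commutatorElement_def, inv_mul_cancel_right, inv_eq_of_mul_eq_one_left hS.J_sq]

theorem isBruhatTriple (hS : SatisfiesRelations h ζ a T J)
    (hζ : ∀ x : Kˣ, x ∈ Subgroup.zpowers ζ) (hord : orderOf ζ = 4 * h * (h + 1)) (hh : 0 < h) :
    IsBruhatTriple hS.torusRelations.torus T J where
  T_sq := hS.T_sq
  J_sq := hS.J_sq
  J_conj_mem := by
    rintro _ ⟨e, rfl⟩
    exact ⟨-e, (hS.J_conj_torusElt e).symm⟩
  T_conj_mem := by
    rintro _ ⟨e, rfl⟩ he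
    have hpos : (0 : ℤ) < 4 * h * (h + 1) := by positivity
    rw [← hS.torusRelations.torusElt_emod] at he ⊢
    have hlt := Int.emod_lt_of_pos e hpos
    lift e % (4 * h * (h + 1)) to ℕ using Int.emod_nonneg e hpos.ne' with j
    have hj : 1 ≤ j := Nat.one_le_iff_ne_zero.2 fun hj => he (by
      rw [hj, Nat.cast_zero, torusElt_zero])
    have hj' : j < 4 * h * (h + 1) := by exact_mod_cast hlt
    obtain ⟨k, hk, hk', hjk⟩ := exists_one_sub_pow_eq_pow hζ hj (hord ▸ hj')
    exact DoubleCoset.mem_doubleCoset.2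
      ⟨_, ⟨k, rfl⟩, _, ⟨_, rfl⟩, hS.T_conj j k hj hj' hk (hord ▸ hk') hjk⟩
  braid := hS.braid

theorem a_mem_torus (hS : SatisfiesRelations h ζ a T J) : a ∈ hS.torusRelations.torus :=
  ⟨-1, torusElt_neg_one _ _⟩

end SatisfiesRelations

section Presentation

variable {p m : ℕ} [Fact p.Prime] {K : Type*} [Field K] (hK : Nat.card K = (p ^ m) ^ 2) {h : ℕ}
  (hq : p ^ m = 2 * h + 1) (hh : 0 < h) {ζ : Kˣ} (hζ : ∀ x : Kˣ, x ∈ Subgroup.zpowers ζ)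

include hK hq hζ

theorem map_twist_zpow (e : ℤ) (u : Kˣ) :
    Units.map ((twist hK (ζ ^ e) : K →+* K) : K →* K) u = u ^ parityScale (2 * h + 1) e := by
  have hord : Even (orderOf ζ) := by
    rw [orderOf_eq_four_mul hq hK hζ, mul_assoc]
    exact (by decide : Even 4).mul_right _
  rw [parityScale]
  split_ifs with he
  · rw [twist_of_isSquare hK ((isSquare_zpow_iff_even hζ hord e).2 he), zpow_one]
    rfl
  · rw [twist_of_not_isSquare hK (mt (isSquare_zpow_iff_even hζ hord e).1 he)]
    ext
    refine (conj_apply hK _).trans ?_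
    rw [hq]
    norm_cast

theorem semiPerm_matR_zpow_mul (e f : ℤ) :
    semiPerm hK (matR (ζ ^ e)) * semiPerm hK (matR (ζ ^ f)) =
      semiPerm hK (matR (ζ ^ (e + parityScale (2 * h + 1) e * f))) := by
  rw [semiPerm_matR_mul, map_twist_zpow hK hq hζ, ← zpow_mul, ← zpow_add, mul_comm f]

theorem commutator_semiPerm_matJ_matR :
    ⁅semiPerm hK (matJ K), semiPerm hK (matR ζ⁻¹)⁆ = semiPerm hK (matR (ζ ^ (2 : ℤ))) := by
  have hJinv : (semiPerm hK (matJ K))⁻¹ = semiPerm hK (matJ K) :=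
    inv_eq_of_mul_eq_one_left (semiPerm_matJ_sq hK)
  rw [commutatorElement_def, hJinv, semiPerm_matJ_conj_matR, inv_inv, mul_inv_eq_iff_eq_mul,
    ← zpow_neg_one, semiPerm_matR_zpow_mul hK hq hζ, parityScale, if_pos even_two]
  norm_num

theorem torusElt_semiPerm (e : ℤ) :
    torusElt ⁅semiPerm hK (matJ K), semiPerm hK (matR ζ⁻¹)⁆ (semiPerm hK (matR ζ⁻¹)) e =
      semiPerm hK (matR (ζ ^ e)) := by
  rw [commutator_semiPerm_matJ_matR hK hq hζ, ← zpow_neg_one]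
  exact torusElt_of_parityScale_mul (r := fun e : ℤ => semiPerm hK (matR (ζ ^ e)))
    (semiPerm_matR_zpow_mul hK hq hζ) e

theorem torusRelations_semiPerm :
    TorusRelations (h : ℤ) ⁅semiPerm hK (matJ K), semiPerm hK (matR ζ⁻¹)⁆
      (semiPerm hK (matR ζ⁻¹)) := by
  rw [commutator_semiPerm_matJ_matR hK hq hζ, ← zpow_neg_one]
  refine torusRelations_of_parityScale_mul (r := fun e : ℤ => semiPerm hK (matR (ζ ^ e)))
    (semiPerm_matR_zpow_mul hK hq hζ) ?_
  have hone : ζ ^ (4 * (h : ℤ) * (h + 1)) = 1 :=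
    orderOf_dvd_iff_zpow_eq_one.1 ⟨1, by rw [orderOf_eq_four_mul hq hK hζ]; push_cast; ring⟩
  refine eq_of_mem_M hK (semiPerm_mem_M hK _) (M hK).one_mem (semiPerm_matR_infty hK _)
    (semiPerm_matR_zero hK _) ?_
  simp only [hone]
  exact semiPerm_matR_one hK 1

include hh

theorem satisfiesRelations_semiPerm :
    SatisfiesRelations h ζ (semiPerm hK (matR ζ⁻¹)) (semiPerm hK (matT K))
      (semiPerm hK (matJ K)) where
  torusRelations := torusRelations_semiPerm hK hq hζ
  T_sq := semiPerm_matT_sq hK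
  J_sq := semiPerm_matJ_sq hK
  braid := semiPerm_braid hK
  T_conj j k _ _ _ _ hjk := by
    have hneg : ζ ^ (2 * (h : ℤ) * (h + 1)) = -1 := by
      have := pow_eq_neg_one_of_orderOf_eq (n := 2 * h * (h + 1)) (by positivity)
        (by rw [orderOf_eq_four_mul hq hK hζ]; ring)
      exact_mod_cast this
    simp only [torusElt_semiPerm hK hq hζ]
    rw [semiPerm_matT_conj_matR hK (w := ζ ^ (k : ℤ)) (by simpa using hjk)]
    have hexp : Units.map ((twist hK (ζ ^ (k : ℤ)) : K →+* K) : K →* K)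
        (-ζ ^ (j : ℤ) * (ζ ^ (k : ℤ))⁻¹) =
          ζ ^ (2 * (h : ℤ) * (h + 1) + parityScale (2 * h + 1) k * (j - k)) := by
      rw [neg_mul, ← neg_one_mul, map_mul, ← zpow_sub, map_twist_zpow hK hq hζ _ (ζ ^ _),
        ← zpow_mul, zpow_add, hneg, mul_comm ((j : ℤ) - k)]
      congr 1
      ext
      simp
    rw [hexp]

end Presentation

theorem satisfiesRelations_of {q h : ℕ} (hq : q = 2 * h + 1) (hh : 0 < h) {K : Type*} [Field K]
    {ζ : Kˣ} :
    SatisfiesRelations h ζ (PresentedGroup.of a : PresentedGroup (relators q ζ))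
      (PresentedGroup.of T) (PresentedGroup.of J) :=
  (satisfiesRelations_map_iff hq hh (PresentedGroup.mk _)).2 fun _ => PresentedGroup.one_of_mem

theorem closure_insert_of {rels : Set (FreeGroup Gen)} {H : Subgroup (PresentedGroup rels)}
    (ha : PresentedGroup.of a ∈ H) :
    Subgroup.closure (insert (PresentedGroup.of T) (insert (PresentedGroup.of J)
      (H : Set (PresentedGroup rels)))) = ⊤ := by
  rw [eq_top_iff, ← PresentedGroup.closure_range_of]
  refine Subgroup.closure_mono ?_
  rintro _ ⟨_ | _ | _, rfl⟩
  · exact Or.inr (Or.inr ha)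
  · exact Or.inl rfl
  · exact Or.inr (Or.inl rfl)

section Isomorphism

variable {p m : ℕ} [Fact p.Prime] {K : Type*} [Field K] (hK : Nat.card K = (p ^ m) ^ 2)

/-- The permutations of the projective line that the symbols `a`, `T`, `J` stand for. -/
noncomputable def genPerm (ζ : Kˣ) : Gen → Equiv.Perm (OnePoint K)
  | a => semiPerm hK (matR ζ⁻¹)
  | T => semiPerm hK (matT K)
  | J => semiPerm hK (matJ K)

variable {h : ℕ} (hq : p ^ m = 2 * h + 1) (hh : 0 < h) {ζ : Kˣ}
  (hζ : ∀ x : Kˣ, x ∈ Subgroup.zpowers ζ)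

include hh hK hq hζ in
theorem lift_genPerm_eq_one : ∀ r ∈ relators (p ^ m) ζ, FreeGroup.lift (genPerm hK ζ) r = 1 :=
  (satisfiesRelations_map_iff hq hh (FreeGroup.lift (genPerm hK ζ))).1 <| by
    simpa only [wa, wT, wJ, FreeGroup.lift_apply_of, genPerm] using
      satisfiesRelations_semiPerm hK hq hh hζ

/-- The action of the presented group on the projective line. -/
noncomputable def presentedPerm :
    PresentedGroup (relators (p ^ m) ζ) →* Equiv.Perm (OnePoint K) :=
  PresentedGroup.toGroup (lift_genPerm_eq_one hK hq hh hζ)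

theorem presentedPerm_of (x : Gen) :
    presentedPerm hK hq hh hζ (PresentedGroup.of x) = genPerm hK ζ x :=
  PresentedGroup.toGroup.of _

theorem presentedPerm_torusElt (e : ℤ) :
    presentedPerm hK hq hh hζ (torusElt
      ⁅PresentedGroup.of (rels := relators (p ^ m) ζ) J, PresentedGroup.of (rels := relators _ ζ) a⁆
      (PresentedGroup.of a) e) = semiPerm hK (matR (ζ ^ e)) := by
  rw [torusElt, map_mul, map_zpow, map_zpow, map_commutatorElement, presentedPerm_of,
    presentedPerm_of]
  exact torusElt_semiPerm hK hq hζ e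

theorem presentedPerm_injective : Function.Injective (presentedPerm hK hq hh hζ) := by
  have hS := satisfiesRelations_of (ζ := ζ) hq hh
  have hord := orderOf_eq_four_mul hq hK hζ
  refine (hS.isBruhatTriple hζ hord hh).map_injective (o := ∞) (z := ((0 : K) : OnePoint K))
    (closure_insert_of hS.a_mem_torus) ?_ ?_ ?_ ?_ ?_ ?_
  · rintro _ ⟨e, rfl⟩
    rw [presentedPerm_torusElt]
    exact semiPerm_matR_infty hK _
  · rintro _ ⟨e, rfl⟩
    rw [presentedPerm_torusElt]
    exact semiPerm_matR_zero hK _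
  · rw [presentedPerm_of]
    exact semiPerm_matT_infty hK
  · rw [presentedPerm_of]
    simp [genPerm, semiPerm_matT_coe]
  · rw [presentedPerm_of]
    simp [genPerm, semiPerm_matJ_infty]
  · rintro _ ⟨e, rfl⟩ he
    have hone : ζ ^ e = 1 := by
      have happly := semiPerm_matR_one hK (ζ ^ e)
      rw [← presentedPerm_torusElt hK hq hh hζ, he, Equiv.Perm.one_apply,
        OnePoint.coe_eq_coe] at happly
      exact Units.ext happly.symm
    refine hS.torusRelations.torusElt_of_dvd ?_
    exact_mod_cast hord ▸ orderOf_dvd_iff_zpow_eq_one.2 hone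

theorem range_presentedPerm : (presentedPerm hK hq hh hζ).range = M hK := by
  have hle : (presentedPerm hK hq hh hζ).range ≤ M hK := by
    rw [MonoidHom.range_eq_map, ← PresentedGroup.closure_range_of, MonoidHom.map_closure,
      Subgroup.closure_le]
    rintro _ ⟨_, ⟨x, rfl⟩, rfl⟩
    rw [presentedPerm_of]
    cases x <;> exact semiPerm_mem_M hK _
  refine eq_M_of_standard_mem hK hle (fun u => ?_) ⟨PresentedGroup.of T, presentedPerm_of ..⟩
    ⟨PresentedGroup.of J, presentedPerm_of ..⟩
  obtain ⟨e, rfl⟩ := Subgroup.mem_zpowers_iff.1 (hζ u)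
  exact ⟨_, presentedPerm_torusElt hK hq hh hζ e⟩

/-- The isomorphism of the presented group with the deformation of `PGL₂(K)` along `φ̄`, obtained
by letting both act on the projective line. -/
noncomputable def presentationEquiv :
    PresentedGroup (relators (p ^ m) ζ) ≃* Deformation (phiBar hK) :=
  ((MonoidHom.ofInjective (presentedPerm_injective hK hq hh hζ)).trans
    (MulEquiv.subgroupCongr (range_presentedPerm hK hq hh hζ))).trans (deformationEquiv hK).symm

theorem presentationEquiv_of {x : Gen} {A : GL (Fin 2) K} (hA : genPerm hK ζ x = semiPerm hK A) :
    presentationEquiv hK hq hh hζ (PresentedGroup.of x) =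
      Deformation.of (phiBar hK) (Matrix.ProjGenLinGroup.mk A) := by
  rw [presentationEquiv, MulEquiv.trans_apply, MulEquiv.symm_apply_eq]
  exact Subtype.ext <|
    (presentedPerm_of hK hq hh hζ x).trans (hA.trans (coe_deformationEquiv_mk hK A).symm)

end Isomorphism

end Zassenhaus

open Zassenhaus in
/-- For `q = p ^ m` an odd prime power, `K` a field of order `q²` and `ζ` a primitive element of
`K`: `M(q²)` is sharply `3`-transitive on `ℙ¹(K)`; replacing `ω` by `β(ω)` in Möbius
transformations is an isomorphism of the deformation of `PGL₂(K)` along `φ̄` onto `M(q²)`; and the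
group presented by the symbols `a, T, J` and the relators is isomorphic to that deformation, with
`a, T, J` corresponding to the classes of `R(ζ⁻¹)`, `!![1, -1; 0, -1]`, `!![0, -1; -1, 0]`. -/
theorem theorem6p14 (p m : ℕ) [Fact p.Prime] (hp : p ≠ 2) (hm : 1 ≤ m)
    (K : Type*) [Field K] (hK : Nat.card K = (p ^ m) ^ 2)
    (ζ : Kˣ) (hζ : ∀ x : Kˣ, x ∈ Subgroup.zpowers ζ) :
    IsSharplyThreeTransitive (M hK) ∧
    (∃ Φ : Deformation (phiBar hK) ≃* M hK, ∀ (A : Matrix.GeneralLinearGroup (Fin 2) K)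
        (ω : OnePoint K),
        (Φ (Deformation.of (phiBar hK) (Matrix.ProjGenLinGroup.mk A)) : Equiv.Perm (OnePoint K)) ω
          = semiMoebius hK A ω) ∧
    (∃ Ψ : PresentedGroup (relators (p ^ m) ζ) ≃* Deformation (phiBar hK),
        Ψ (PresentedGroup.of Gen.a) =
          Deformation.of (phiBar hK) (Matrix.ProjGenLinGroup.mk (matR ζ⁻¹)) ∧
        Ψ (PresentedGroup.of Gen.T) =
          Deformation.of (phiBar hK) (Matrix.ProjGenLinGroup.mk (matT K)) ∧
        Ψ (PresentedGroup.of Gen.J) =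
          Deformation.of (phiBar hK) (Matrix.ProjGenLinGroup.mk (matJ K))) := by
  obtain ⟨h, hq⟩ : Odd (p ^ m) := ((Fact.out : p.Prime).odd_of_ne_two hp).pow
  have hh : 0 < h := by
    have hone : 1 < p ^ m := Nat.one_lt_pow (by lia) (Fact.out : p.Prime).one_lt
    lia
  refine ⟨isSharplyThreeTransitive_M hK, ⟨deformationEquiv hK, ?_⟩,
    ⟨presentationEquiv hK hq hh hζ, ?_⟩⟩
  · exact semiPerm_eq_semiMoebius hK
  · exact ⟨presentationEquiv_of hK hq hh hζ rfl, presentationEquiv_of hK hq hh hζ rfl,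
      presentationEquiv_of hK hq hh hζ rfl⟩
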